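/- Let $n\ge 1$ and $f(v)=|v|^{4/n}\,v\,e^{v^2}$. Let $\exp L^2$ be the space of all $g\in L^1_{loc}(\mathbb R^n)$ with $\int_{\mathbb R^n}(e^{(|g|/\lambda)^2}-1)\,dx<\infty$ for some $\lambda>0$, with the Luxemburg norm $\|g\|_{\exp L^2}=\inf\{\lambda>0:\int_{\mathbb R^n}(e^{(|g|/\lambda)^2}-1)\,dx\le 1\}$; its predual is the Orlicz space of the function complementary to $t\mapsto e^{t^2}-1$. A function $u$ is called a (mild) solution of $$\partial_t u=\Delta u+f(u)\ \text{ in }(0,\infty)\times\mathbb R^n,\qquad u(0)=\varphi, \qquad (1)$$ if $u\in L^\infty(0,\infty;\exp L^2)\cap C((0,\infty);\exp L^2)$, $u(t)=e^{t\Delta}\varphi+\int_0^t e^{(t-s)\Delta}f(u(s))\,ds$ for all $t>0$, and $\int_{\mathbb R^n}(u(t)\psi-\varphi\psi)\,dx\to 0$ as $t\to 0^+$ for every $\psi$ in the predual of $\exp L^2$. For $p\in[1,2)$ put $$p_*=\max\Big\{p,\frac{2n}{n+4}\Big\},\qquad p_1=\max\Big\{1,\frac{2n}{n+4}\Big\},\qquad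 \|\varphi\|_{\exp L^2\cap L^{p_*}}=\max\{\|\varphi\|_{\exp L^2},\|\varphi\|_{L^{p_*}}\}.$$ **Theorem.** There exist constants $\varepsilon=\varepsilon(n)>0$, $C=C(n)>0$ and a positive function $F=F(n,\cdot,\cdot)$ such that the following holds. Let $p\in[1,2)$ and $\varphi\in\exp L^2\cap L^p$ with $\varphi\ge 0$, and assume that (1) has a unique positive (i.e. nonnegative) solution $u$ satisfying $\sup_{t>0}\|u(t)\|_{\exp L^2}\le 2\|\varphi\|_{\exp L^2}$. If $$\|\varphi\|_{\exp L^2}<\min\big(\varepsilon,\;F(n,p_*,\|\varphi\|_{L^{p_*}})\big),$$ then $$\|u(t)\|_{L^q}\le C\,t^{-\frac n2\left(\frac1{p_*}-\frac1q\right)}\|\varphi\|_{\exp L^2\cap L^{p_*}}\qquad\text{for all }t>0\text{ and all }q\in[p_*,\infty].$$ If moreover $p\in(p_1,2)$, then for every $q\in[p_*,\infty]$ $$\|u(t)\|_{L^q}=o\Big(t^{-\frac n2\left(\frac1{p_*}-\frac1q\right)}\Big)\qquad\text{as }t\to\infty.$$ -/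

import Mathlib

open MeasureTheory Set Filter Topology Asymptotics

noncomputable section

namespace ExpHeat

/-- `ℝⁿ` with its Euclidean norm. -/
abbrev Space (n : ℕ) : Type := EuclideanSpace ℝ (Fin n)

/-! ### Orlicz spaces -/

/-- The modular `∫ A(|g(x)| / l) dx`, with values in `[0, ∞]`, of the Young function `A ≥ 0`. -/
def modular {n : ℕ} (A : ℝ → ℝ) (g : Space n → ℝ) (l : ℝ) : ENNReal :=
  ∫⁻ x, ENNReal.ofReal (A (|g x| / l))

/-- The Orlicz space `L^A(ℝⁿ)`: all locally integrable `g` such that `∫ A(|g| / l) < ∞` for some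
`l > 0`. -/
def MemOrlicz {n : ℕ} (A : ℝ → ℝ) (g : Space n → ℝ) : Prop :=
  LocallyIntegrable g ∧ ∃ l : ℝ, 0 < l ∧ modular A g l < ⊤

/-- The Luxemburg norm `inf {l > 0 | ∫ A(|g| / l) ≤ 1}`; it is only used for members of `L^A`. -/
def luxemburgNorm {n : ℕ} (A : ℝ → ℝ) (g : Space n → ℝ) : ℝ :=
  sInf {l : ℝ | 0 < l ∧ modular A g l ≤ 1}

/-- The complementary (Young conjugate) function `s ↦ sup_{t ≥ 0} (s t - A t)`. -/
def complementary (A : ℝ → ℝ) (s : ℝ) : ℝ :=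
  sSup ((fun t : ℝ => s * t - A t) '' Ici 0)

/-- The Young function `t ↦ exp (t²) - 1`. -/
def expYoung (t : ℝ) : ℝ := Real.exp (t ^ 2) - 1

/-- Membership in `exp L²(ℝⁿ)`. -/
def MemExpL2 {n : ℕ} (g : Space n → ℝ) : Prop := MemOrlicz expYoung g

/-- The norm of `exp L²(ℝⁿ)`. -/
def expL2Norm {n : ℕ} (g : Space n → ℝ) : ℝ := luxemburgNorm expYoung g

/-- Membership in the predual of `exp L²(ℝⁿ)`, the Orlicz space of the function complementary to
`t ↦ exp (t²) - 1`. -/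
def MemPredual {n : ℕ} (g : Space n → ℝ) : Prop := MemOrlicz (complementary expYoung) g

/-! ### The heat equation with exponential nonlinearity -/

/-- The Gauss kernel `(4πt)^(-n/2) exp (-|x|² / (4t))`. -/
def heatKernel {n : ℕ} (t : ℝ) (x : Space n) : ℝ :=
  (4 * Real.pi * t) ^ (-(n : ℝ) / 2) * Real.exp (-‖x‖ ^ 2 / (4 * t))

/-- The heat semigroup `(e^{tΔ} g)(x) = ∫ G(t, x - y) g(y) dy`. -/
def heat {n : ℕ} (t : ℝ) (g : Space n → ℝ) (x : Space n) : ℝ :=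
  ∫ y, heatKernel t (x - y) * g y

/-- The nonlinearity `f(v) = |v|^{4/n} v e^{v²}`. -/
def nonlin (n : ℕ) (v : ℝ) : ℝ := |v| ^ (4 / (n : ℝ)) * v * Real.exp (v ^ 2)

/-- `u` is a mild solution on `(0, ∞) × ℝⁿ` of `∂ₜu = Δu + f(u)`, `u(0) = φ`. Only the values `u t`
with `t > 0`, modulo equality almost everywhere on `ℝⁿ`, matter. -/
structure IsMildSolution {n : ℕ} (φ : Space n → ℝ) (u : ℝ → Space n → ℝ) : Prop where
  mem : ∀ t : ℝ, 0 < t → MemExpL2 (u t)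
  /-- `u` belongs to `L^∞(0, ∞; exp L²)`. -/
  bounded : ∃ B : ℝ, ∀ t : ℝ, 0 < t → expL2Norm (u t) ≤ B
  /-- `u` belongs to `C((0, ∞); exp L²)`. -/
  cont : ∀ t : ℝ, 0 < t → Tendsto (fun s : ℝ => expL2Norm (u s - u t)) (𝓝 t) (𝓝 0)
  /-- `u(t) = e^{tΔ} φ + ∫₀ᵗ e^{(t-s)Δ} f(u(s)) ds`, the integrals being convergent. -/
  duhamel : ∀ t : ℝ, 0 < t → ∀ᵐ x : Space n,
    (∀ᵐ s ∂(volume.restrict (Ioo 0 t)),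
      Integrable (fun y : Space n => heatKernel (t - s) (x - y) * nonlin n (u s y))) ∧
    IntegrableOn (fun s : ℝ => heat (t - s) (fun y => nonlin n (u s y)) x) (Ioo 0 t) ∧
    u t x = heat t φ x + ∫ s in Ioo 0 t, heat (t - s) (fun y => nonlin n (u s y)) x
  /-- `u(t) → φ` in the weak-* topology of `exp L²` as `t → 0`. -/
  initial : ∀ ψ : Space n → ℝ, MemPredual ψ →
    Tendsto (fun t : ℝ => ∫ x, (u t x * ψ x - φ x * ψ x)) (𝓝[>] 0) (𝓝 0)

/-- `u` is a positive (that is, nonnegative) mild solution with initial value `φ` such that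
`sup_{t > 0} ‖u(t)‖_{exp L²} ≤ 2 ‖φ‖_{exp L²}`. -/
structure IsPositiveBoundedSolution {n : ℕ} (φ : Space n → ℝ) (u : ℝ → Space n → ℝ) : Prop where
  mild : IsMildSolution φ u
  nonneg : ∀ t : ℝ, 0 < t → ∀ᵐ x, 0 ≤ u t x
  bound : ∀ t : ℝ, 0 < t → expL2Norm (u t) ≤ 2 * expL2Norm φ

/-- `u` is the unique positive mild solution with initial value `φ` obeying
`sup_{t > 0} ‖u(t)‖_{exp L²} ≤ 2 ‖φ‖_{exp L²}`. -/
structure IsUniquePositiveBoundedSolution {n : ℕ} (φ : Space n → ℝ) (u : ℝ → Space n → ℝ) :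
    Prop where
  sol : IsPositiveBoundedSolution φ u
  unique : ∀ v : ℝ → Space n → ℝ, IsPositiveBoundedSolution φ v → ∀ t : ℝ, 0 < t → v t =ᵐ[volume] u t

/-! ### Exponents and norms -/

/-- `p_* = max {p, 2n/(n+4)}`. -/
def pStar (n : ℕ) (p : ℝ) : ℝ := max p (2 * n / (n + 4))

/-- `p₁ = max {1, 2n/(n+4)}`. -/
def pOne (n : ℕ) : ℝ := max 1 (2 * n / (n + 4))

/-- The real-valued norm of `L^p(ℝⁿ)` for a real exponent `p`, only used for members of `L^p`. -/
def lpNorm {n : ℕ} (p : ℝ) (g : Space n → ℝ) : ℝ := (eLpNorm g (ENNReal.ofReal p) volume).toReal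

/-- The norm of `exp L² ∩ L^p`. -/
def interNorm {n : ℕ} (p : ℝ) (g : Space n → ℝ) : ℝ := max (expL2Norm g) (lpNorm p g)

/-- The exponent `-(n/2) (1/r - 1/q)`, where `1/q = 0` for `q = ∞`. -/
def decayExponent (n : ℕ) (r : ℝ) (q : ENNReal) : ℝ := -((n : ℝ) / 2) * (1 / r - (q⁻¹).toReal)

end ExpHeat

end

/-!
Write `r = p_*`, `α = n / (2 r)` and `M` for the `exp L²` norm of `φ`. The exponent `r` satisfies
`1 ≤ r < 2` and `r (1 + 4 / n) ≥ 2`, and `f(v)` behaves like `|v| ^ (1 + 4 / n)` near zero. Two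
facts about the source term `f(u)` carry the proof.

* Since `u(s)` has `exp L²` norm at most `2 M` with `M` small, `f(u(s))` is bounded by a multiple of
  `M ^ (1 + 4 / n)` in every `L^k` with `max {1, 2n / (n + 4)} ≤ k ≤ n + 1`, uniformly in `s`
  (`eLpNorm_nonlin_le`). This covers `k = r` and also `k = n + 1 > n / 2`, for which the smoothing
  factor `(t - s) ^ (-n / (2 k))` is integrable up to `s = t`.
* If `‖u(s)‖_r ≤ X` and `‖u(s)‖_∞ ≤ X s ^ (-α) ≤ 1`, then
  `‖f(u(s))‖_r ≤ e X ^ (1 + 4 / n) s ^ (-2/r)`, with a further factor `s ^ (-α)` in `L^∞`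
  (`DecayBound.nonlin_le`), and `2 / r > 1` makes this integrable at infinity.

The decay estimate in `L^r` and in `L^∞` is proved directly from Duhamel's formula by a continuity
argument (`decayBound_of_sourceBound`). A time `T`, depending on `n`, `r` and `‖φ‖_r`, is chosen so
large that the tail `∫_T^∞ s ^ (-2/r) ds` is harmless; then `M` is taken so small, which is the role
of `F`, that the source term is negligible up to time `2 T`. If the estimate holds before a time
`S`, the first fact shows that it persists shortly after `S`. All other exponents follow by
interpolation.

For the second assertion, when `r > p_1` the source term is bounded in `L^{p_1}` as well, and `φ` is
approximated in `L^r` by functions in `L^{p_1}`; so everything but a small tail gains a negative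
power of `t` (`eventually_decayBound`).

No joint measurability of `u` in time and space is assumed. The one place where it matters is
Minkowski's inequality for the Duhamel integral, and there it is recovered from the continuity of
`e^{(t-s)Δ} f(u(s))` in `x` and its measurability in `s` (`exists_measurable_uncurry_ae_eq`).
-/

namespace ExpHeat

open scoped ENNReal

variable {n : ℕ}

/-! ### Lebesgue norms -/

theorem eLpNorm_ofReal_le_iff {α E : Type*} [MeasurableSpace α] {μ : Measure α} [ENorm E]
    {g : α → E} {k : ℝ} (hk : 0 < k) {B : ℝ≥0∞} :
    eLpNorm g (ENNReal.ofReal k) μ ≤ B ↔ ∫⁻ x, ‖g x‖ₑ ^ k ∂μ ≤ B ^ k := by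
  rw [eLpNorm_eq_lintegral_rpow_enorm_toReal (by simpa using hk) ENNReal.ofReal_ne_top,
    ENNReal.toReal_ofReal hk.le, one_div, ENNReal.rpow_inv_le_iff hk]

theorem lintegral_rpow_enorm_eq {α E : Type*} [MeasurableSpace α] {μ : Measure α} [ENorm E]
    (g : α → E) {k : ℝ} (hk : 0 < k) :
    ∫⁻ x, ‖g x‖ₑ ^ k ∂μ = eLpNorm g (ENNReal.ofReal k) μ ^ k := by
  rw [eLpNorm_eq_lintegral_rpow_enorm_toReal (by simpa using hk) ENNReal.ofReal_ne_top,
    ENNReal.toReal_ofReal hk.le, one_div, ENNReal.rpow_inv_rpow hk.ne']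

/-- Interpolation between `L^r` and `L^∞`. -/
theorem eLpNorm_le_rpow_mul_rpow_top {α : Type*} [MeasurableSpace α] {μ : Measure α}
    {v : α → ℝ} {r : ℝ} (hr : 0 < r) {q : ℝ≥0∞} (hq : ENNReal.ofReal r ≤ q) {A B : ℝ}
    (hA : 0 < A) (hB : 0 < B) (hvA : eLpNorm v (ENNReal.ofReal r) μ ≤ ENNReal.ofReal A)
    (hvB : eLpNorm v ⊤ μ ≤ ENNReal.ofReal B) :
    eLpNorm v q μ ≤
      ENNReal.ofReal (A ^ (r * (q⁻¹).toReal) * B ^ (1 - r * (q⁻¹).toReal)) := by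
  rcases eq_or_ne q ⊤ with rfl | hqt
  · simpa using hvB
  lift q to NNReal using hqt
  have hrq : r ≤ (q : ℝ) := by
    rw [← ENNReal.ofReal_coe_nnreal] at hq
    exact (ENNReal.ofReal_le_ofReal_iff q.coe_nonneg).1 hq
  have hq0 : 0 < (q : ℝ) := hr.trans_le hrq
  have hqinv : ((q : ℝ≥0∞)⁻¹).toReal = (q : ℝ)⁻¹ := by simp
  rw [hqinv, ← ENNReal.ofReal_coe_nnreal, eLpNorm_ofReal_le_iff hq0]
  have hpt : ∀ᵐ x ∂μ, ‖v x‖ₑ ^ (q : ℝ) ≤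
      ENNReal.ofReal (B ^ ((q : ℝ) - r)) * ‖v x‖ₑ ^ r := by
    have := ae_le_eLpNormEssSup (f := v) (μ := μ)
    filter_upwards [this] with x hx
    have hx' : ‖v x‖ₑ ≤ ENNReal.ofReal B := hx.trans (by rwa [← eLpNorm_exponent_top])
    calc ‖v x‖ₑ ^ (q : ℝ) = ‖v x‖ₑ ^ ((q : ℝ) - r) * ‖v x‖ₑ ^ r := by
          rw [← ENNReal.rpow_add_of_nonneg _ _ (by linarith) hr.le]; congr 1; ring
      _ ≤ _ := by
          rw [← ENNReal.ofReal_rpow_of_pos hB]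
          gcongr
  calc ∫⁻ x, ‖v x‖ₑ ^ (q : ℝ) ∂μ
      ≤ ∫⁻ x, ENNReal.ofReal (B ^ ((q : ℝ) - r)) * ‖v x‖ₑ ^ r ∂μ := lintegral_mono_ae hpt
    _ = ENNReal.ofReal (B ^ ((q : ℝ) - r)) * ∫⁻ x, ‖v x‖ₑ ^ r ∂μ :=
        lintegral_const_mul' _ _ ENNReal.ofReal_ne_top
    _ ≤ ENNReal.ofReal (B ^ ((q : ℝ) - r)) * ENNReal.ofReal A ^ r := by
        gcongr; exact (eLpNorm_ofReal_le_iff hr).1 hvA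
    _ = _ := by
        rw [ENNReal.ofReal_rpow_of_pos hA, ← ENNReal.ofReal_mul (by positivity),
          ENNReal.ofReal_rpow_of_pos (by positivity), Real.mul_rpow (by positivity) (by positivity),
          ← Real.rpow_mul hA.le, ← Real.rpow_mul hB.le, mul_comm]
        congr 3 <;> field_simp

/-- A form of Minkowski's integral inequality: if `‖g(s, ·)‖_k ≤ w(s)`, then
`‖∫ g(s, ·) ds‖_k ≤ ∫ w(s) ds`. -/
theorem lintegral_rpow_lintegral_le {S X : Type*} [MeasurableSpace S] [MeasurableSpace X]
    {ν : Measure S} {μ : Measure X} [SFinite ν] [SFinite μ] {g : S → X → ℝ≥0∞}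
    (hg : Measurable (Function.uncurry g)) {w : S → ℝ≥0∞} (hw : Measurable w)
    (hw0 : ∀ᵐ s ∂ν, w s ≠ 0) (hwt : ∀ᵐ s ∂ν, w s ≠ ⊤) {k : ℝ} (hk : 1 ≤ k)
    (hgw : ∀ᵐ s ∂ν, ∫⁻ x, g s x ^ k ∂μ ≤ w s ^ k) :
    ∫⁻ x, (∫⁻ s, g s x ∂ν) ^ k ∂μ ≤ (∫⁻ s, w s ∂ν) ^ k := by
  have hk0 : 0 < k := by linarith
  have hgs : ∀ x, Measurable fun s => g s x := fun x => hg.comp measurable_prodMk_right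
  have hgx : ∀ s, Measurable fun x => g s x := fun s => hg.comp measurable_prodMk_left
  have key : ∀ x, (∫⁻ s, g s x ∂ν) ^ k ≤
      (∫⁻ s, w s ∂ν) ^ (k - 1) * ∫⁻ s, g s x ^ k * w s ^ (1 - k) ∂ν := by
    intro x
    have h1 : ∫⁻ s, g s x ∂ν =
        ∫⁻ s, (g s x ^ k * w s ^ (1 - k)) ^ (1 / k) * w s ^ (1 - 1 / k) ∂ν := by
      refine lintegral_congr_ae ?_
      filter_upwards [hw0, hwt] with s h0 ht
      rw [ENNReal.mul_rpow_of_nonneg _ _ (by positivity), ← ENNReal.rpow_mul, ← ENNReal.rpow_mul,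
        mul_assoc, ← ENNReal.rpow_add _ _ h0 ht]
      have e1 : k * (1 / k) = 1 := by field_simp
      have e2 : (1 - k) * (1 / k) + (1 - 1 / k) = 0 := by field_simp; ring
      rw [e1, e2]; simp
    rw [h1]
    have h2 := ENNReal.lintegral_mul_norm_pow_le (μ := ν)
      (f := fun s => g s x ^ k * w s ^ (1 - k)) (g := w)
      (((hgs x).pow_const k).mul (hw.pow_const _)).aemeasurable hw.aemeasurable
      (p := 1 / k) (q := 1 - 1 / k) (by positivity)
      (by rw [sub_nonneg]; exact (div_le_one hk0).2 hk) (by ring)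
    calc _ ≤ ((∫⁻ s, g s x ^ k * w s ^ (1 - k) ∂ν) ^ (1 / k) *
          (∫⁻ s, w s ∂ν) ^ (1 - 1 / k)) ^ k := by gcongr
      _ = _ := by
        rw [ENNReal.mul_rpow_of_nonneg _ _ hk0.le, ← ENNReal.rpow_mul, ← ENNReal.rpow_mul, mul_comm]
        have e1 : 1 / k * k = 1 := by field_simp
        have e2 : (1 - 1 / k) * k = k - 1 := by field_simp
        rw [e1, e2, ENNReal.rpow_one]
  have hjm : Measurable (Function.uncurry fun x s => g s x ^ k * w s ^ (1 - k)) := by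
    refine Measurable.mul (Measurable.pow_const ?_ _) ((hw.comp measurable_snd).pow_const _)
    exact hg.comp measurable_swap
  calc ∫⁻ x, (∫⁻ s, g s x ∂ν) ^ k ∂μ
      ≤ ∫⁻ x, (∫⁻ s, w s ∂ν) ^ (k - 1) * ∫⁻ s, g s x ^ k * w s ^ (1 - k) ∂ν ∂μ :=
        lintegral_mono key
    _ = (∫⁻ s, w s ∂ν) ^ (k - 1) * ∫⁻ x, ∫⁻ s, g s x ^ k * w s ^ (1 - k) ∂ν ∂μ :=
        lintegral_const_mul _ hjm.lintegral_prod_right'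
    _ = (∫⁻ s, w s ∂ν) ^ (k - 1) * ∫⁻ s, ∫⁻ x, g s x ^ k * w s ^ (1 - k) ∂μ ∂ν := by
        rw [lintegral_lintegral_swap hjm.aemeasurable]
    _ ≤ (∫⁻ s, w s ∂ν) ^ (k - 1) * ∫⁻ s, w s ∂ν := by
        gcongr 1
        refine lintegral_mono_ae ?_
        filter_upwards [hw0, hwt, hgw] with s h0 ht h
        rw [lintegral_mul_const _ ((hgx s).pow_const k)]
        calc _ ≤ w s ^ k * w s ^ (1 - k) := by gcongr
          _ = w s := by rw [← ENNReal.rpow_add _ _ h0 ht]; simp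
    _ = (∫⁻ s, w s ∂ν) ^ k := by
        conv_lhs => rw [← ENNReal.rpow_one (∫⁻ s, w s ∂ν), ← ENNReal.rpow_mul, one_mul]
        rw [← ENNReal.rpow_add_of_nonneg _ _ (by linarith) zero_le_one]
        congr 1; ring

/-! ### The heat semigroup on Lebesgue spaces -/

theorem heatKernel_nonneg {τ : ℝ} (hτ : 0 < τ) (x : Space n) : 0 ≤ heatKernel τ x := by
  unfold heatKernel; positivity

theorem continuous_heatKernel (τ : ℝ) : Continuous (heatKernel τ : Space n → ℝ) := by
  unfold heatKernel; fun_prop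

theorem heatKernel_le {τ : ℝ} (hτ : 0 < τ) (x : Space n) :
    heatKernel τ x ≤ τ ^ (-(n : ℝ) / 2) := by
  unfold heatKernel
  have h1 : (4 * Real.pi * τ) ^ (-(n : ℝ) / 2) ≤ τ ^ (-(n : ℝ) / 2) := by
    apply Real.rpow_le_rpow_of_nonpos hτ
    · nlinarith [Real.pi_gt_three]
    · have : (0 : ℝ) ≤ n := by positivity
      linarith
  have h2 : Real.exp (-‖x‖ ^ 2 / (4 * τ)) ≤ 1 := by
    rw [Real.exp_le_one_iff, neg_div, neg_nonpos]; positivity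
  calc _ ≤ τ ^ (-(n : ℝ) / 2) * 1 := by gcongr
    _ = _ := mul_one _

theorem lintegral_heatKernel {τ : ℝ} (hτ : 0 < τ) :
    ∫⁻ x : Space n, ENNReal.ofReal (heatKernel τ x) = 1 := by
  have hb : 0 < 1 / (4 * τ) := by positivity
  have hI := GaussianFourier.integral_rexp_neg_mul_sq_norm (V := Space n) hb
  have hval : ∫ x : Space n, heatKernel τ x = 1 := by
    have : ∀ x : Space n, heatKernel τ x =
        (4 * Real.pi * τ) ^ (-(n : ℝ) / 2) * Real.exp (-(1 / (4 * τ)) * ‖x‖ ^ 2) := by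
      intro x; unfold heatKernel; congr 2; field_simp
    simp_rw [this]
    rw [integral_const_mul, hI, finrank_euclideanSpace, Fintype.card_fin]
    have e : Real.pi / (1 / (4 * τ)) = 4 * Real.pi * τ := by field_simp
    rw [e, ← Real.rpow_add (by positivity)]
    have : -(n : ℝ) / 2 + n / 2 = 0 := by ring
    rw [this, Real.rpow_zero]
  have hint : Integrable (heatKernel τ : Space n → ℝ) := by
    by_contra h
    rw [integral_undef h] at hval
    exact zero_ne_one hval
  rw [← ofReal_integral_eq_lintegral_ofReal hint (ae_of_all _ fun x => heatKernel_nonneg hτ x),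
    hval, ENNReal.ofReal_one]

theorem lintegral_heatKernel_sub_left {τ : ℝ} (hτ : 0 < τ) (x : Space n) :
    ∫⁻ y : Space n, ENNReal.ofReal (heatKernel τ (x - y)) = 1 := by
  rw [lintegral_sub_left_eq_self (fun y : Space n => ENNReal.ofReal (heatKernel τ y)),
    lintegral_heatKernel hτ]

theorem lintegral_heatKernel_sub_right {τ : ℝ} (hτ : 0 < τ) (y : Space n) :
    ∫⁻ x : Space n, ENNReal.ofReal (heatKernel τ (x - y)) = 1 := by
  rw [lintegral_sub_right_eq_self (fun x : Space n => ENNReal.ofReal (heatKernel τ x)),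
    lintegral_heatKernel hτ]

theorem measurable_heatKernel_sub (τ : ℝ) (x : Space n) :
    Measurable fun y : Space n => ENNReal.ofReal (heatKernel τ (x - y)) :=
  ((continuous_heatKernel τ).comp (continuous_const.sub continuous_id)).measurable.ennreal_ofReal

/-- Jensen's inequality for the probability density `G(τ, x - ·)`. -/
theorem lintegral_heatKernel_mul_rpow_le {τ : ℝ} (hτ : 0 < τ) {h : Space n → ℝ}
    (hh : AEStronglyMeasurable h volume) {k : ℝ} (hk : 1 ≤ k) (x : Space n) :
    (∫⁻ y, ENNReal.ofReal (heatKernel τ (x - y)) * ‖h y‖ₑ) ^ k ≤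
      ∫⁻ y, ENNReal.ofReal (heatKernel τ (x - y)) * ‖h y‖ₑ ^ k := by
  have hk0 : 0 < k := by linarith
  have hk1 : 0 ≤ 1 - 1 / k := by rw [sub_nonneg]; exact (div_le_one hk0).2 hk
  have hG := measurable_heatKernel_sub τ x
  have h2 := ENNReal.lintegral_mul_norm_pow_le (μ := (volume : Measure (Space n)))
    (f := fun y => ENNReal.ofReal (heatKernel τ (x - y)) * ‖h y‖ₑ ^ k)
    (g := fun y => ENNReal.ofReal (heatKernel τ (x - y)))
    (hG.aemeasurable.mul (hh.enorm.pow_const k)) hG.aemeasurable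
    (p := 1 / k) (q := 1 - 1 / k) (by positivity) hk1 (by ring)
  rw [lintegral_heatKernel_sub_left hτ, ENNReal.one_rpow, mul_one, one_div,
    ENNReal.le_rpow_inv_iff hk0] at h2
  refine le_trans (le_of_eq ?_) h2
  congr 1
  refine lintegral_congr fun y => ?_
  rw [ENNReal.mul_rpow_of_nonneg _ _ (by positivity), ENNReal.rpow_rpow_inv hk0.ne', mul_right_comm,
    ← ENNReal.rpow_add_of_nonneg _ _ (by positivity) (by rwa [← one_div])]
  simp

theorem enorm_heat_le {τ : ℝ} (hτ : 0 < τ) (h : Space n → ℝ) (x : Space n) :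
    ‖heat τ h x‖ₑ ≤ ∫⁻ y, ENNReal.ofReal (heatKernel τ (x - y)) * ‖h y‖ₑ := by
  refine (enorm_integral_le_lintegral_enorm _).trans (le_of_eq (lintegral_congr fun y => ?_))
  rw [enorm_mul, Real.enorm_of_nonneg (heatKernel_nonneg hτ _)]

theorem lintegral_heatKernel_mul_le {τ : ℝ} (hτ : 0 < τ) {h : Space n → ℝ}
    (hh : AEStronglyMeasurable h volume) {k : ℝ} (hk : 1 ≤ k) (x : Space n) :
    ∫⁻ y, ENNReal.ofReal (heatKernel τ (x - y)) * ‖h y‖ₑ ≤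
      ENNReal.ofReal (τ ^ (-((n : ℝ) / (2 * k)))) * eLpNorm h (ENNReal.ofReal k) volume := by
  have hk0 : 0 < k := by linarith
  have h1 := lintegral_heatKernel_mul_rpow_le hτ hh hk x
  rw [← ENNReal.le_rpow_inv_iff hk0] at h1
  refine h1.trans ?_
  rw [ENNReal.rpow_inv_le_iff hk0, ENNReal.mul_rpow_of_nonneg _ _ hk0.le,
    ← lintegral_rpow_enorm_eq h hk0, ENNReal.ofReal_rpow_of_pos (by positivity),
    ← Real.rpow_mul hτ.le, ← lintegral_const_mul' _ _ ENNReal.ofReal_ne_top]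
  refine lintegral_mono fun y => ?_
  gcongr
  refine (heatKernel_le hτ _).trans (le_of_eq ?_)
  congr 1; field_simp

/-- The smoothing effect `‖e^{τΔ} h‖_∞ ≤ τ^{-n/(2k)} ‖h‖_k`. -/
theorem enorm_heat_le_rpow_mul {τ : ℝ} (hτ : 0 < τ) {h : Space n → ℝ}
    (hh : AEStronglyMeasurable h volume) {k : ℝ} (hk : 1 ≤ k) (x : Space n) :
    ‖heat τ h x‖ₑ ≤
      ENNReal.ofReal (τ ^ (-((n : ℝ) / (2 * k)))) * eLpNorm h (ENNReal.ofReal k) volume :=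
  (enorm_heat_le hτ h x).trans (lintegral_heatKernel_mul_le hτ hh hk x)

theorem enorm_heat_le_top {τ : ℝ} (hτ : 0 < τ) (h : Space n → ℝ) (x : Space n) :
    ‖heat τ h x‖ₑ ≤ eLpNorm h ⊤ volume := by
  refine (enorm_heat_le hτ h x).trans ?_
  calc _ ≤ ∫⁻ y, ENNReal.ofReal (heatKernel τ (x - y)) * eLpNorm h ⊤ volume := by
        refine lintegral_mono_ae ?_
        filter_upwards [ae_le_eLpNormEssSup (f := h) (μ := volume)] with y hy
        rw [eLpNorm_exponent_top]
        gcongr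
    _ = _ := by
        rw [lintegral_mul_const _ (measurable_heatKernel_sub τ x),
          lintegral_heatKernel_sub_left hτ, one_mul]

theorem eLpNorm_heat_le {τ : ℝ} (hτ : 0 < τ) {h : Space n → ℝ}
    (hh : AEStronglyMeasurable h volume) {k : ℝ} (hk : 1 ≤ k) :
    eLpNorm (heat τ h) (ENNReal.ofReal k) volume ≤ eLpNorm h (ENNReal.ofReal k) volume := by
  have hk0 : 0 < k := by linarith
  rw [eLpNorm_ofReal_le_iff hk0, ← lintegral_rpow_enorm_eq h hk0]
  have hm : AEMeasurable (Function.uncurry fun x y : Space n =>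
      ENNReal.ofReal (heatKernel τ (x - y)) * ‖h y‖ₑ ^ k)
      ((volume : Measure (Space n)).prod volume) := by
    refine AEMeasurable.mul ?_ ?_
    · exact ((continuous_heatKernel τ).comp
        (continuous_fst.sub continuous_snd)).measurable.ennreal_ofReal.aemeasurable
    · exact (hh.comp_snd.enorm).pow_const k
  calc ∫⁻ x, ‖heat τ h x‖ₑ ^ k
      ≤ ∫⁻ x, ∫⁻ y, ENNReal.ofReal (heatKernel τ (x - y)) * ‖h y‖ₑ ^ k := by
        refine lintegral_mono fun x => ?_
        exact (ENNReal.rpow_le_rpow (enorm_heat_le hτ h x) hk0.le).trans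
          (lintegral_heatKernel_mul_rpow_le hτ hh hk x)
    _ = ∫⁻ y, ∫⁻ x, ENNReal.ofReal (heatKernel τ (x - y)) * ‖h y‖ₑ ^ k :=
        lintegral_lintegral_swap hm
    _ = ∫⁻ y, ‖h y‖ₑ ^ k := by
        refine lintegral_congr fun y => ?_
        have : Measurable fun x : Space n => ENNReal.ofReal (heatKernel τ (x - y)) :=
          ((continuous_heatKernel τ).comp
            (continuous_id.sub continuous_const)).measurable.ennreal_ofReal
        rw [lintegral_mul_const _ this, lintegral_heatKernel_sub_right hτ, one_mul]

theorem integrable_heatKernel_mul {τ : ℝ} (hτ : 0 < τ) {h : Space n → ℝ} {k : ℝ} (hk : 1 ≤ k)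
    (hh : MemLp h (ENNReal.ofReal k) volume) (x : Space n) :
    Integrable fun y => heatKernel τ (x - y) * h y := by
  refine ⟨?_, ?_⟩
  · exact (((continuous_heatKernel τ).comp
      (continuous_const.sub continuous_id)).aestronglyMeasurable).mul hh.1
  · rw [HasFiniteIntegral]
    have := lintegral_heatKernel_mul_le hτ hh.1 hk x
    refine lt_of_le_of_lt ?_ (this.trans_lt (ENNReal.mul_lt_top ENNReal.ofReal_lt_top hh.2))
    refine lintegral_mono fun y => ?_
    rw [enorm_mul, Real.enorm_of_nonneg (heatKernel_nonneg hτ _)]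

theorem continuous_heat {τ : ℝ} (hτ : 0 < τ) {h : Space n → ℝ} {k : ℝ} (hk : 1 ≤ k)
    (hh : MemLp h (ENNReal.ofReal k) volume) : Continuous (heat τ h) := by
  rw [continuous_iff_continuousAt]
  intro x₀
  set c : ℝ := (4 * Real.pi * τ) ^ (-(n : ℝ) / 2) * Real.exp (1 / (4 * τ)) /
    (4 * Real.pi * (2 * τ)) ^ (-(n : ℝ) / 2) with hc
  -- Near `x₀` the kernel is dominated by a multiple of the kernel at time `2τ` centred at `x₀`.
  have hdom : ∀ x y : Space n, ‖x - x₀‖ ≤ 1 →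
      heatKernel τ (x - y) ≤ c * heatKernel (2 * τ) (x₀ - y) := by
    intro x y hx
    have hsq : ‖x₀ - y‖ ^ 2 ≤ 2 * ‖x - y‖ ^ 2 + 2 := by
      have h1 : ‖x₀ - y‖ ≤ ‖x - y‖ + ‖x - x₀‖ := by
        have : x₀ - y = (x - y) - (x - x₀) := by abel
        rw [this]; exact norm_sub_le _ _
      have h2 : ‖x₀ - y‖ ≤ ‖x - y‖ + 1 := by linarith
      nlinarith [norm_nonneg (x₀ - y), norm_nonneg (x - y), sq_nonneg (‖x - y‖ - 1)]
    have hpos : (0 : ℝ) < (4 * Real.pi * (2 * τ)) ^ (-(n : ℝ) / 2) := by positivity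
    have : c * heatKernel (2 * τ) (x₀ - y) = (4 * Real.pi * τ) ^ (-(n : ℝ) / 2) *
        Real.exp (1 / (4 * τ) + -‖x₀ - y‖ ^ 2 / (4 * (2 * τ))) := by
      rw [hc, heatKernel, Real.exp_add]; field_simp
    rw [this, heatKernel]
    gcongr
    have e : 1 / (4 * τ) + -‖x₀ - y‖ ^ 2 / (4 * (2 * τ)) =
      (1 - ‖x₀ - y‖ ^ 2 / 2) / (4 * τ) := by field_simp; ring
    rw [e]
    gcongr
    linarith
  refine continuousAt_of_dominated
    (bound := fun y => ‖c * (heatKernel (2 * τ) (x₀ - y) * h y)‖) ?_ ?_ ?_ ?_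
  · exact Eventually.of_forall fun x => (integrable_heatKernel_mul hτ hk hh x).1
  · filter_upwards [Metric.closedBall_mem_nhds x₀ one_pos] with x hx
    refine ae_of_all _ fun y => ?_
    rw [mem_closedBall_iff_norm] at hx
    rw [← mul_assoc, norm_mul, norm_mul]
    gcongr
    rw [Real.norm_of_nonneg (heatKernel_nonneg hτ _)]
    exact (hdom x y hx).trans (le_abs_self _)
  · exact ((integrable_heatKernel_mul (by positivity) hk hh x₀).const_mul c).norm
  · refine ae_of_all _ fun y => ?_
    exact (((continuous_heatKernel τ).comp
      (continuous_id.sub continuous_const)).mul continuous_const).continuousAt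

theorem heat_add {τ : ℝ} (hτ : 0 < τ) {g h : Space n → ℝ} {k l : ℝ} (hk : 1 ≤ k) (hl : 1 ≤ l)
    (hg : MemLp g (ENNReal.ofReal k) volume) (hh : MemLp h (ENNReal.ofReal l) volume) :
    heat τ (g + h) = heat τ g + heat τ h := by
  ext x
  simp only [heat, Pi.add_apply, mul_add]
  exact integral_add (integrable_heatKernel_mul hτ hk hg x) (integrable_heatKernel_mul hτ hl hh x)

/-- The smoothing effect `‖e^{τΔ} h‖_r ≤ τ^{-(n/2)(1/l - 1/r)} ‖h‖_l` for `1 ≤ l ≤ r < ∞`. -/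
theorem eLpNorm_heat_le_rpow_mul {τ : ℝ} (hτ : 0 < τ) {h : Space n → ℝ}
    (hh : AEStronglyMeasurable h volume) {l r : ℝ} (hl : 1 ≤ l) (hlr : l ≤ r) {B : ℝ} (hB : 0 < B)
    (hhB : eLpNorm h (ENNReal.ofReal l) volume ≤ ENNReal.ofReal B) :
    eLpNorm (heat τ h) (ENNReal.ofReal r) volume ≤
      ENNReal.ofReal (τ ^ (-((n : ℝ) / 2 * (1 / l - 1 / r))) * B) := by
  have hl0 : 0 < l := by linarith
  have hr0 : 0 < r := by linarith
  have htop : eLpNorm (heat τ h) ⊤ volume ≤ ENNReal.ofReal (τ ^ (-((n : ℝ) / (2 * l))) * B) := by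
    rw [eLpNorm_exponent_top]
    refine essSup_le_of_ae_le _ (ae_of_all _ fun x => ?_)
    refine (enorm_heat_le_rpow_mul hτ hh hl x).trans ?_
    rw [ENNReal.ofReal_mul (by positivity)]
    exact mul_le_mul' le_rfl hhB
  have := eLpNorm_le_rpow_mul_rpow_top hl0 (ENNReal.ofReal_le_ofReal hlr) hB (by positivity)
    ((eLpNorm_heat_le hτ hh hl).trans hhB) htop
  refine this.trans (le_of_eq ?_)
  have hinv : ((ENNReal.ofReal r)⁻¹).toReal = r⁻¹ := by
    rw [ENNReal.toReal_inv, ENNReal.toReal_ofReal hr0.le]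
  rw [hinv, Real.mul_rpow (by positivity) hB.le, ← Real.rpow_mul hτ.le, mul_left_comm,
    ← Real.rpow_add hB]
  congr 2
  · congr 1; field_simp
  · rw [add_sub_cancel, Real.rpow_one]

/-! ### The space `exp L²` and the nonlinearity -/

theorem expL2Norm_nonneg (g : Space n → ℝ) : 0 ≤ expL2Norm g :=
  Real.sInf_nonneg fun _ hl => hl.1.le

theorem expYoung_nonneg (t : ℝ) : 0 ≤ expYoung t := by
  have := Real.add_one_le_exp (t ^ 2)
  unfold expYoung; nlinarith [sq_nonneg t]

theorem sq_le_expYoung (t : ℝ) : t ^ 2 ≤ expYoung t := by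
  have := Real.add_one_le_exp (t ^ 2)
  unfold expYoung; linarith

theorem modular_anti (g : Space n → ℝ) {l l' : ℝ} (hl : 0 < l) (hll' : l ≤ l') :
    modular expYoung g l' ≤ modular expYoung g l := by
  refine lintegral_mono fun x => ENNReal.ofReal_le_ofReal ?_
  unfold expYoung
  have := hl.trans_le hll'
  gcongr

/-- By convexity the modular at `c l` is at most `1 / c` times the modular at `l`, so that some
modular is at most `1`. -/
theorem exists_modular_le_one {g : Space n → ℝ} (hg : MemExpL2 g) :
    ∃ l : ℝ, 0 < l ∧ modular expYoung g l ≤ 1 := by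
  obtain ⟨l, hl, hfin⟩ := hg.2
  set K := (modular expYoung g l).toReal with hK
  have hK0 : 0 ≤ K := ENNReal.toReal_nonneg
  have hc : 0 < 1 + K := by linarith
  refine ⟨l * (1 + K), by positivity, ?_⟩
  have hpt : ∀ x, expYoung (|g x| / (l * (1 + K))) ≤ (1 + K)⁻¹ * expYoung (|g x| / l) := by
    intro x
    set y := (|g x| / l) ^ 2 with hy
    have hθ0 : 0 ≤ (1 + K)⁻¹ := by positivity
    have hθ1 : (1 + K)⁻¹ ≤ 1 := inv_le_one_of_one_le₀ (by linarith)
    have e1 : (|g x| / (l * (1 + K))) ^ 2 = (1 + K)⁻¹ * ((1 + K)⁻¹ * y) := by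
      rw [hy]; field_simp
    have h1 : (1 + K)⁻¹ * ((1 + K)⁻¹ * y) ≤ (1 + K)⁻¹ * y := by
      gcongr
      exact mul_le_of_le_one_left (by positivity) hθ1
    have h2 := convexOn_exp.2 (mem_univ y) (mem_univ 0) hθ0 (sub_nonneg.2 hθ1) (by ring)
    simp only [smul_eq_mul, mul_zero, add_zero, Real.exp_zero, mul_one] at h2
    unfold expYoung
    rw [e1, ← hy]
    have := Real.exp_le_exp.2 h1
    linarith
  calc modular expYoung g (l * (1 + K))
      ≤ ∫⁻ x, ENNReal.ofReal (1 + K)⁻¹ * ENNReal.ofReal (expYoung (|g x| / l)) := by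
        refine lintegral_mono fun x => ?_
        rw [← ENNReal.ofReal_mul (by positivity)]
        exact ENNReal.ofReal_le_ofReal (hpt x)
    _ = ENNReal.ofReal (1 + K)⁻¹ * modular expYoung g l :=
        lintegral_const_mul' _ _ ENNReal.ofReal_ne_top
    _ = ENNReal.ofReal ((1 + K)⁻¹ * K) := by
        rw [ENNReal.ofReal_mul (by positivity), hK, ENNReal.ofReal_toReal hfin.ne]
    _ ≤ 1 := by
        rw [← ENNReal.ofReal_one]
        refine ENNReal.ofReal_le_ofReal ?_
        rw [inv_mul_le_iff₀ hc]; linarith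

theorem modular_le_one_of_expL2Norm_lt {g : Space n → ℝ} (hg : MemExpL2 g) {l : ℝ}
    (hl : expL2Norm g < l) : modular expYoung g l ≤ 1 := by
  obtain ⟨l', ⟨hl'0, hl'⟩, hlt⟩ := exists_lt_of_csInf_lt (exists_modular_le_one hg) hl
  exact (modular_anti g hl'0 hlt.le).trans hl'

theorem MemExpL2.aestronglyMeasurable {g : Space n → ℝ} (hg : MemExpL2 g) :
    AEStronglyMeasurable g volume := hg.1.aestronglyMeasurable

theorem eLpNorm_two_le_of_modular_le_one {g : Space n → ℝ} {l : ℝ} (hl : 0 < l)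
    (hg : modular expYoung g l ≤ 1) : eLpNorm g (ENNReal.ofReal 2) volume ≤ ENNReal.ofReal l := by
  rw [eLpNorm_ofReal_le_iff two_pos, ENNReal.ofReal_rpow_of_pos hl]
  calc ∫⁻ x, ‖g x‖ₑ ^ (2 : ℝ)
      ≤ ∫⁻ x, ENNReal.ofReal (l ^ (2 : ℝ)) * ENNReal.ofReal (expYoung (|g x| / l)) := by
        refine lintegral_mono fun x => ?_
        rw [← ENNReal.ofReal_mul (by positivity), Real.enorm_eq_ofReal_abs,
          ENNReal.ofReal_rpow_of_nonneg (abs_nonneg _) zero_le_two]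
        refine ENNReal.ofReal_le_ofReal ?_
        have := sq_le_expYoung (|g x| / l)
        rw [div_pow, div_le_iff₀ (by positivity)] at this
        rw [Real.rpow_two, Real.rpow_two]; linarith
    _ = ENNReal.ofReal (l ^ (2 : ℝ)) * modular expYoung g l :=
        lintegral_const_mul' _ _ ENNReal.ofReal_ne_top
    _ ≤ ENNReal.ofReal (l ^ (2 : ℝ)) * 1 := by gcongr
    _ = _ := mul_one _

theorem MemExpL2.memLp_two {g : Space n → ℝ} (hg : MemExpL2 g) :
    MemLp g (ENNReal.ofReal 2) volume := by
  obtain ⟨l, hl, h⟩ := exists_modular_le_one hg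
  exact ⟨hg.aestronglyMeasurable,
    (eLpNorm_two_le_of_modular_le_one hl h).trans_lt ENNReal.ofReal_lt_top⟩

theorem ae_eq_zero_of_expL2Norm_le_zero {g : Space n → ℝ} (hg : MemExpL2 g)
    (h : expL2Norm g ≤ 0) : g =ᵐ[volume] 0 := by
  rw [← eLpNorm_eq_zero_iff (p := ENNReal.ofReal 2) hg.aestronglyMeasurable (by simp),
    ← nonpos_iff_eq_zero]
  refine ENNReal.le_of_forall_pos_le_add fun δ hδ _ => ?_
  have := eLpNorm_two_le_of_modular_le_one (NNReal.coe_pos.2 hδ)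
    (modular_le_one_of_expL2Norm_lt hg (h.trans_lt (NNReal.coe_pos.2 hδ)))
  simpa using this

theorem memLp_of_memLp_of_memLp_two {g : Space n → ℝ} {p r : ℝ} (hp : 0 < p) (hpr : p ≤ r)
    (hr : r ≤ 2) (h1 : MemLp g (ENNReal.ofReal p) volume) (h2 : MemLp g (ENNReal.ofReal 2) volume) :
    MemLp g (ENNReal.ofReal r) volume := by
  have hr0 : 0 < r := hp.trans_le hpr
  refine ⟨h1.1, ?_⟩
  have i1 := lintegral_rpow_enorm_eq (μ := volume) g hp
  have i2 := lintegral_rpow_enorm_eq (μ := volume) g two_pos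
  have ir := lintegral_rpow_enorm_eq (μ := volume) g hr0
  have hlt : ∫⁻ x, ‖g x‖ₑ ^ r < ⊤ := by
    calc ∫⁻ x, ‖g x‖ₑ ^ r ≤ ∫⁻ x, (‖g x‖ₑ ^ p + ‖g x‖ₑ ^ (2 : ℝ)) := by
          refine lintegral_mono fun x => ?_
          rcases le_total ‖g x‖ₑ 1 with hx | hx
          · exact (ENNReal.rpow_le_rpow_of_exponent_ge hx hpr).trans le_self_add
          · exact (ENNReal.rpow_le_rpow_of_exponent_le hx hr).trans le_add_self
      _ = (∫⁻ x, ‖g x‖ₑ ^ p) + ∫⁻ x, ‖g x‖ₑ ^ (2 : ℝ) :=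
          lintegral_add_left' (h1.1.enorm.pow_const p) _
      _ < ⊤ := by
          rw [i1, i2]
          exact ENNReal.add_lt_top.2 ⟨ENNReal.rpow_lt_top_of_nonneg hp.le h1.2.ne,
            ENNReal.rpow_lt_top_of_nonneg two_pos.le h2.2.ne⟩
  rw [ir] at hlt
  by_contra hcon
  rw [not_lt, top_le_iff] at hcon
  rw [hcon, ENNReal.top_rpow_of_pos hr0] at hlt
  exact lt_irrefl _ hlt

theorem continuous_nonlin (n : ℕ) : Continuous (nonlin n) := by
  unfold nonlin
  have : Continuous fun v : ℝ => |v| ^ (4 / (n : ℝ)) :=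
    continuous_abs.rpow_const fun _ => Or.inr (by positivity)
  fun_prop

theorem abs_nonlin (hn : 1 ≤ n) (v : ℝ) :
    |nonlin n v| = |v| ^ (1 + 4 / (n : ℝ)) * Real.exp (v ^ 2) := by
  have : (0 : ℝ) < n := by exact_mod_cast hn
  rw [nonlin, abs_mul, abs_mul, abs_of_nonneg (Real.exp_nonneg _),
    abs_of_nonneg (Real.rpow_nonneg (abs_nonneg v) _),
    Real.rpow_add_of_nonneg (abs_nonneg v) zero_le_one (by positivity), Real.rpow_one,
    mul_comm |v|]

/-- Where `|v| ≤ b ≤ 1` the exponential factor is harmless. -/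
theorem abs_nonlin_le (hn : 1 ≤ n) {v b : ℝ} (hv : |v| ≤ b) (hb : b ≤ 1) :
    |nonlin n v| ≤ Real.exp 1 * b ^ (4 / (n : ℝ)) * |v| := by
  have hn' : (0 : ℝ) < n := by exact_mod_cast hn
  have hb0 : 0 ≤ b := (abs_nonneg v).trans hv
  have hexp : Real.exp (v ^ 2) ≤ Real.exp 1 := by
    rw [Real.exp_le_exp, ← sq_abs]
    exact pow_le_one₀ (abs_nonneg v) (hv.trans hb)
  rw [abs_nonlin hn, Real.rpow_add_of_nonneg (abs_nonneg v) zero_le_one (by positivity),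
    Real.rpow_one]
  calc |v| * |v| ^ (4 / (n : ℝ)) * Real.exp (v ^ 2)
      ≤ |v| * b ^ (4 / (n : ℝ)) * Real.exp 1 := by gcongr
    _ = _ := by ring

/-- The constant in the bound of the nonlinearity in `L^k`. -/
def nonlinConst (n : ℕ) : ℝ := 2 * ((n + 9).factorial * 2 ^ (n + 9))

theorem two_le_nonlinConst (n : ℕ) : 2 ≤ nonlinConst n := by
  have h1 : (1 : ℝ) ≤ (n + 9).factorial := by exact_mod_cast (n + 9).factorial_pos
  have h2 : (1 : ℝ) ≤ 2 ^ (n + 9) := one_le_pow₀ one_le_two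
  unfold nonlinConst
  nlinarith

theorem rpow_mul_exp_le_expYoung {w m : ℝ} (hw : 0 ≤ w) (hm : 2 ≤ m) (hmn : m ≤ 2 * (n + 9)) :
    w ^ m * Real.exp (w ^ 2 / 2) ≤ nonlinConst n * expYoung w := by
  rcases le_total w 1 with h1 | h1
  · have hw2 : w ^ m ≤ w ^ 2 := by
      rw [← Real.rpow_two]
      exact Real.rpow_le_rpow_of_exponent_ge_of_imp hw h1 hm (by intro _ h; linarith)
    have he : Real.exp (w ^ 2 / 2) ≤ 2 := by
      have : Real.exp (w ^ 2 / 2) ≤ Real.exp (1 / 2) := by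
        rw [Real.exp_le_exp]; nlinarith
      have h3 : Real.exp (1 / 2) * Real.exp (1 / 2) < 2.7182818286 := by
        rw [← Real.exp_add, add_halves]; exact Real.exp_one_lt_d9
      nlinarith [Real.exp_pos (1 / 2)]
    calc w ^ m * Real.exp (w ^ 2 / 2) ≤ w ^ 2 * 2 := by gcongr
      _ ≤ expYoung w * nonlinConst n := by
        gcongr
        · exact expYoung_nonneg w
        · exact sq_le_expYoung w
        · exact two_le_nonlinConst n
      _ = _ := mul_comm _ _
  · have hp : w ^ m ≤ (n + 9).factorial * 2 ^ (n + 9) * Real.exp (w ^ 2 / 2) := by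
      have h2 := Real.pow_div_factorial_le_exp (x := w ^ 2 / 2) (by positivity) (n + 9)
      rw [div_le_iff₀ (by positivity), div_pow, div_le_iff₀ (by positivity)] at h2
      calc w ^ m ≤ w ^ (2 * ((n : ℝ) + 9)) := Real.rpow_le_rpow_of_exponent_le h1 hmn
        _ = (w ^ 2) ^ (n + 9) := by
          rw [← pow_mul, ← Real.rpow_natCast]; push_cast; rfl
        _ ≤ _ := h2
        _ = _ := by ring
    have hE : Real.exp (w ^ 2) ≤ 2 * expYoung w := by
      have : (2 : ℝ) ≤ Real.exp (w ^ 2) := by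
        have := Real.add_one_le_exp (w ^ 2)
        nlinarith
      unfold expYoung; linarith
    calc w ^ m * Real.exp (w ^ 2 / 2)
        ≤ (n + 9).factorial * 2 ^ (n + 9) * Real.exp (w ^ 2 / 2) * Real.exp (w ^ 2 / 2) := by
          gcongr
      _ = (n + 9).factorial * 2 ^ (n + 9) * Real.exp (w ^ 2) := by
          rw [mul_assoc, ← Real.exp_add]; ring_nf
      _ ≤ (n + 9).factorial * 2 ^ (n + 9) * (2 * expYoung w) := by gcongr
      _ = _ := by unfold nonlinConst; ring

/-- If the `exp L²` norm of `g` is at most `L` and `L` is small, then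
`‖f(g)‖_k ≤ C L^{1 + 4/n}` for every `k` with `k (1 + 4/n) ≥ 2`; this is the origin of the
exponent `2n/(n+4)`. -/
theorem eLpNorm_nonlin_le (hn : 1 ≤ n) {g : Space n → ℝ} {L : ℝ} (hL : 0 < L)
    (hLn : (n + 1) * L ^ 2 ≤ 1 / 2) (hg : modular expYoung g L ≤ 1) {k : ℝ} (hk1 : 1 ≤ k)
    (hk2 : 2 * n / (n + 4) ≤ k) (hkn : k ≤ n + 1) :
    eLpNorm (fun x => nonlin n (g x)) (ENNReal.ofReal k) volume ≤
      ENNReal.ofReal (nonlinConst n * L ^ (1 + 4 / (n : ℝ))) := by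
  have hn' : (1 : ℝ) ≤ n := by exact_mod_cast hn
  have hk0 : 0 < k := by linarith
  have hC := two_le_nonlinConst n
  set σ : ℝ := 4 / (n : ℝ) with hσ
  have hσ0 : 0 < σ := by positivity
  have hσ4 : σ ≤ 4 := by rw [hσ, div_le_iff₀ (by linarith)]; linarith
  have hnσ : n * σ = 4 := by rw [hσ]; field_simp
  have hm2 : 2 ≤ (1 + σ) * k := by
    rw [div_le_iff₀ (by linarith)] at hk2
    nlinarith
  have hmn : (1 + σ) * k ≤ 2 * (n + 9) := by nlinarith
  rw [eLpNorm_ofReal_le_iff hk0, ENNReal.ofReal_rpow_of_pos (by positivity),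
    Real.mul_rpow (by positivity) (by positivity), ← Real.rpow_mul hL.le]
  have hpt : ∀ x, ‖nonlin n (g x)‖ₑ ^ k ≤
      ENNReal.ofReal (nonlinConst n * L ^ ((1 + σ) * k)) *
        ENNReal.ofReal (expYoung (|g x| / L)) := by
    intro x
    rw [← ENNReal.ofReal_mul (by positivity), Real.enorm_eq_ofReal_abs,
      ENNReal.ofReal_rpow_of_nonneg (abs_nonneg _) hk0.le]
    refine ENNReal.ofReal_le_ofReal ?_
    set w := |g x| / L with hw
    have hw0 : 0 ≤ w := by positivity
    have hgw : |g x| = L * w := by rw [hw]; field_simp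
    have hsq : (g x) ^ 2 * k ≤ w ^ 2 / 2 := by
      rw [← sq_abs, hgw]
      have : k * L ^ 2 ≤ 1 / 2 := by nlinarith [sq_nonneg L]
      nlinarith [sq_nonneg w]
    rw [abs_nonlin hn, Real.mul_rpow (by positivity) (by positivity), ← Real.rpow_mul (abs_nonneg _),
      ← Real.exp_mul, hgw, Real.mul_rpow hL.le hw0]
    have := rpow_mul_exp_le_expYoung hw0 hm2 hmn
    calc L ^ ((1 + σ) * k) * w ^ ((1 + σ) * k) * Real.exp ((g x) ^ 2 * k)
        ≤ L ^ ((1 + σ) * k) * w ^ ((1 + σ) * k) * Real.exp (w ^ 2 / 2) := by gcongr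
      _ = L ^ ((1 + σ) * k) * (w ^ ((1 + σ) * k) * Real.exp (w ^ 2 / 2)) := by ring
      _ ≤ L ^ ((1 + σ) * k) * (nonlinConst n * expYoung w) := by gcongr
      _ = _ := by ring
  calc ∫⁻ x, ‖nonlin n (g x)‖ₑ ^ k
      ≤ ∫⁻ x, ENNReal.ofReal (nonlinConst n * L ^ ((1 + σ) * k)) *
        ENNReal.ofReal (expYoung (|g x| / L)) := lintegral_mono hpt
    _ = ENNReal.ofReal (nonlinConst n * L ^ ((1 + σ) * k)) * modular expYoung g L :=
        lintegral_const_mul' _ _ ENNReal.ofReal_ne_top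
    _ ≤ ENNReal.ofReal (nonlinConst n * L ^ ((1 + σ) * k)) * 1 := by gcongr
    _ ≤ ENNReal.ofReal (nonlinConst n ^ k * L ^ ((1 + σ) * k)) := by
        rw [mul_one]
        refine ENNReal.ofReal_le_ofReal ?_
        gcongr
        exact Real.self_le_rpow_of_one_le (by linarith) hk1

theorem eLpNorm_nonlin_le_of_eLpNorm_top_le (hn : 1 ≤ n) {g : Space n → ℝ} {b : ℝ} (hb1 : b ≤ 1)
    (hgb : eLpNorm g ⊤ volume ≤ ENNReal.ofReal b) (hb0 : 0 ≤ b) (q : ℝ≥0∞) :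
    eLpNorm (fun x => nonlin n (g x)) q volume ≤
      ENNReal.ofReal (Real.exp 1 * b ^ (4 / (n : ℝ))) * eLpNorm g q volume := by
  refine eLpNorm_le_mul_eLpNorm_of_ae_le_mul ?_ q
  filter_upwards [ae_le_eLpNormEssSup (f := g) (μ := volume)] with x hx
  refine abs_nonlin_le hn ?_ hb1
  rw [← eLpNorm_exponent_top] at hx
  have := hx.trans hgb
  rwa [Real.enorm_eq_ofReal_abs, ENNReal.ofReal_le_ofReal_iff hb0] at this

/-! ### Norm estimates of Duhamel's formula -/

/-- An almost-everywhere Carathéodory function agrees, for almost every value of the measurable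
variable, with a jointly measurable one. -/
theorem exists_measurable_uncurry_ae_eq {S X : Type*} [MeasurableSpace S] {ν : Measure S}
    [TopologicalSpace X] [TopologicalSpace.MetrizableSpace X] [SecondCountableTopology X]
    [MeasurableSpace X] [OpensMeasurableSpace X] {μ : Measure X} [μ.IsOpenPosMeasure]
    {G : S → X → ℝ} (hcont : ∀ᵐ s ∂ν, Continuous (G s))
    (hmeas : ∀ᵐ x ∂μ, AEStronglyMeasurable (fun s => G s x) ν) :
    ∃ g : S → X → ℝ, Measurable (Function.uncurry g) ∧ ∀ᵐ s ∂ν, g s = G s := by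
  classical
  have hdense : Dense {x | AEStronglyMeasurable (fun s => G s x) ν} :=
    Measure.dense_of_ae hmeas
  obtain ⟨D, hDsub, hDc, hDd⟩ := hdense.exists_countable_dense_subset
  have hmk : ∀ d : X, ∃ m : S → ℝ, Measurable m ∧ (d ∈ D → ∀ᵐ s ∂ν, G s d = m s) := by
    intro d
    by_cases hd : d ∈ D
    · have h : AEMeasurable (fun s => G s d) ν := (hDsub hd).aemeasurable
      exact ⟨h.mk _, h.measurable_mk, fun _ => h.ae_eq_mk⟩
    · exact ⟨0, measurable_const, fun h => absurd h hd⟩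
  choose m hm hmG using hmk
  have hgood : ∀ᵐ s ∂ν, Continuous (G s) ∧ ∀ d ∈ D, G s d = m d s :=
    hcont.and ((ae_ball_iff hDc).2 fun d hd => hmG d hd)
  obtain ⟨N, hNsub, hNm, hN0⟩ := exists_measurable_superset_of_null (ae_iff.1 hgood)
  have hN : ∀ s, s ∉ N → Continuous (G s) ∧ ∀ d ∈ D, G s d = m d s := by
    intro s hs
    by_contra h
    exact hs (hNsub h)
  set g : S → X → ℝ := fun s x => if s ∈ N then 0 else G s x with hg
  have hgc : ∀ s, Continuous (g s) := by
    intro s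
    by_cases hs : s ∈ N
    · simpa [hg, hs] using continuous_const
    · simpa [hg, hs] using (hN s hs).1
  have hgD : ∀ d ∈ D, Measurable fun s => g s d := by
    intro d hd
    have : (fun s => g s d) = fun s => if s ∈ N then 0 else m d s := by
      ext s
      by_cases hs : s ∈ N
      · simp [hg, hs]
      · simp [hg, hs, (hN s hs).2 d hd]
    rw [this]
    exact Measurable.ite hNm measurable_const (hm d)
  have hgx : ∀ x, Measurable fun s => g s x := by
    intro x
    obtain ⟨d, hdD, hdx⟩ := mem_closure_iff_seq_limit.1 (hDd x)
    refine measurable_of_tendsto_metrizable (f := fun i s => g s (d i)) (fun i => hgD _ (hdD i)) ?_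
    rw [tendsto_pi_nhds]
    exact fun s => ((hgc s).tendsto x).comp hdx
  refine ⟨g, ?_, ?_⟩
  · exact (measurable_uncurry_of_continuous_of_measurable (u := fun x s => g s x) hgc hgx).comp
      measurable_swap
  · filter_upwards [measure_eq_zero_iff_ae_notMem.1 hN0] with s hs
    ext x
    simp [hg, hs]

namespace IsMildSolution

variable {φ : Space n → ℝ} {u : ℝ → Space n → ℝ}

theorem eLpNorm_le (hu : IsMildSolution φ u) {t : ℝ} (ht : 0 < t) {r : ℝ} (hr : 1 ≤ r)
    (hφ : MemLp φ (ENNReal.ofReal r) volume)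
    (hf : ∀ s ∈ Ioo 0 t, MemLp (fun y => nonlin n (u s y)) (ENNReal.ofReal r) volume)
    {w : ℝ → ℝ} (hw : Measurable w) (hw0 : ∀ s ∈ Ioo 0 t, 0 < w s)
    (hfw : ∀ s ∈ Ioo 0 t, eLpNorm (heat (t - s) fun y => nonlin n (u s y)) (ENNReal.ofReal r)
      volume ≤ ENNReal.ofReal (w s)) :
    eLpNorm (u t) (ENNReal.ofReal r) volume ≤
      eLpNorm (heat t φ) (ENNReal.ofReal r) volume + ∫⁻ s in Ioo 0 t, ENNReal.ofReal (w s) := by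
  have hr0 : 0 < r := by linarith
  set V : Space n → ℝ := fun x => ∫ s in Ioo 0 t, heat (t - s) (fun y => nonlin n (u s y)) x
    with hV
  have hφm : AEStronglyMeasurable (heat t φ) volume :=
    (continuous_heat ht hr hφ).aestronglyMeasurable
  have heq : u t =ᵐ[volume] heat t φ + V := by
    filter_upwards [hu.duhamel t ht] with x hx using hx.2.2
  have hVm : AEStronglyMeasurable V volume := by
    refine ((hu.mem t ht).aestronglyMeasurable.sub hφm).congr ?_
    filter_upwards [heq] with x hx
    simp [hx]
  obtain ⟨g, hgm, hg⟩ := exists_measurable_uncurry_ae_eq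
    (ν := volume.restrict (Ioo 0 t)) (μ := (volume : Measure (Space n)))
    (G := fun s => heat (t - s) fun y => nonlin n (u s y))
    (by
      filter_upwards [ae_restrict_mem measurableSet_Ioo] with s hs
      exact continuous_heat (sub_pos.2 hs.2) hr (hf s hs))
    (by
      filter_upwards [hu.duhamel t ht] with x hx using hx.2.1.1)
  rw [eLpNorm_congr_ae heq]
  refine (eLpNorm_add_le hφm hVm (by simpa using hr)).trans ?_
  gcongr
  rw [eLpNorm_ofReal_le_iff hr0]
  calc ∫⁻ x, ‖V x‖ₑ ^ r
      ≤ ∫⁻ x, (∫⁻ s in Ioo 0 t, ‖g s x‖ₑ) ^ r := by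
        refine lintegral_mono fun x => ?_
        refine ENNReal.rpow_le_rpow ?_ hr0.le
        refine (enorm_integral_le_lintegral_enorm _).trans (le_of_eq (lintegral_congr_ae ?_))
        filter_upwards [hg] with s hs
        rw [hs]
    _ ≤ (∫⁻ s in Ioo 0 t, ENNReal.ofReal (w s)) ^ r := by
        refine lintegral_rpow_lintegral_le (g := fun s x => ‖g s x‖ₑ) hgm.enorm hw.ennreal_ofReal
          ?_ (ae_of_all _ fun s => ENNReal.ofReal_ne_top) hr ?_
        · filter_upwards [ae_restrict_mem measurableSet_Ioo] with s hs
          simpa using hw0 s hs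
        · filter_upwards [ae_restrict_mem measurableSet_Ioo, hg] with s hs hgs
          rw [hgs, ← eLpNorm_ofReal_le_iff hr0]
          exact hfw s hs

theorem eLpNorm_top_le (hu : IsMildSolution φ u) {t : ℝ} (ht : 0 < t) {A : ℝ≥0∞}
    (hφ : ∀ x, ‖heat t φ x‖ₑ ≤ A) {w : ℝ → ℝ}
    (hfw : ∀ s ∈ Ioo 0 t, ∀ x,
      ‖heat (t - s) (fun y => nonlin n (u s y)) x‖ₑ ≤ ENNReal.ofReal (w s)) :
    eLpNorm (u t) ⊤ volume ≤ A + ∫⁻ s in Ioo 0 t, ENNReal.ofReal (w s) := by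
  rw [eLpNorm_exponent_top]
  refine essSup_le_of_ae_le _ ?_
  filter_upwards [hu.duhamel t ht] with x hx
  rw [hx.2.2]
  refine (enorm_add_le _ _).trans (add_le_add (hφ x) ?_)
  refine (enorm_integral_le_lintegral_enorm _).trans (lintegral_mono_ae ?_)
  filter_upwards [ae_restrict_mem measurableSet_Ioo] with s hs using hfw s hs x

end IsMildSolution

/-! ### Time integrals -/

theorem lintegral_Ioo_rpow_sub_le {a β S t : ℝ} (ha : 0 ≤ a) (hβ : β ≤ 1 / 2) (hSt : S ≤ t) :
    ∫⁻ s in Ioo S t, ENNReal.ofReal ((t - s) ^ (-β) * a) ≤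
      ENNReal.ofReal (2 * a * (t - S) ^ (1 - β)) := by
  have hii : IntervalIntegrable (fun s => (t - s) ^ (-β) * a) volume S t := by
    have h := (intervalIntegral.intervalIntegrable_rpow' (a := t - S) (b := t - t) (r := -β)
      (by linarith)).comp_sub_left t
    simp only [sub_sub_cancel] at h
    exact h.mul_const a
  have hio : IntegrableOn (fun s => (t - s) ^ (-β) * a) (Ioo S t) volume :=
    ((intervalIntegrable_iff_integrableOn_Ioc_of_le hSt).1 hii).mono_set Ioo_subset_Ioc_self
  rw [← ofReal_integral_eq_lintegral_ofReal hio]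
  · refine ENNReal.ofReal_le_ofReal ?_
    rw [← integral_Ioc_eq_integral_Ioo, ← intervalIntegral.integral_of_le hSt,
      intervalIntegral.integral_mul_const,
      intervalIntegral.integral_comp_sub_left (fun s => s ^ (-β)) t, sub_self,
      integral_rpow (Or.inl (by linarith)), Real.zero_rpow (by linarith), sub_zero,
      show -β + 1 = 1 - β by ring]
    have h0 : 0 ≤ (t - S) ^ (1 - β) := Real.rpow_nonneg (by linarith) _
    have : (t - S) ^ (1 - β) / (1 - β) ≤ 2 * (t - S) ^ (1 - β) := by
      rw [div_le_iff₀ (by linarith)]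
      nlinarith
    nlinarith
  · filter_upwards [ae_restrict_mem measurableSet_Ioo] with s hs
    have : 0 ≤ (t - s) ^ (-β) := Real.rpow_nonneg (by linarith [hs.2]) _
    positivity

theorem lintegral_Ioi_rpow_le {c ρ T : ℝ} (hc : 0 ≤ c) (hρ : 1 < ρ) (hT : 0 < T) :
    ∫⁻ s in Ioi T, ENNReal.ofReal (c * s ^ (-ρ)) ≤
      ENNReal.ofReal (c * (T ^ (1 - ρ) / (ρ - 1))) := by
  rw [← ofReal_integral_eq_lintegral_ofReal
    ((integrableOn_Ioi_rpow_of_lt (by linarith) hT).const_mul c)]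
  · refine ENNReal.ofReal_le_ofReal (le_of_eq ?_)
    rw [integral_const_mul, integral_Ioi_rpow_of_lt (by linarith) hT, show -ρ + 1 = 1 - ρ by ring,
      neg_div, ← div_neg, neg_sub]
  · filter_upwards [ae_restrict_mem measurableSet_Ioi] with s hs
    have : 0 < s := hT.trans hs
    positivity

theorem lintegral_Ioo_ite_le (w₁ w₂ w₃ : ℝ → ℝ≥0∞) {T S t : ℝ} :
    ∫⁻ s in Ioo 0 t, (if s < T then w₁ s else if s < S then w₂ s else w₃ s) ≤
      (∫⁻ s in Ioo 0 T, w₁ s) + (∫⁻ s in Ioi T, w₂ s) + ∫⁻ s in Ioo S t, w₃ s := by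
  have hsub : Ioo 0 t ⊆ (Ioo 0 T ∪ Ici T ∩ Iio S) ∪ (Ici T ∩ Ico S t) := by
    intro s hs
    by_cases h1 : s < T
    · exact Or.inl (Or.inl ⟨hs.1, h1⟩)
    · by_cases h2 : s < S
      · exact Or.inl (Or.inr ⟨not_lt.1 h1, h2⟩)
      · exact Or.inr ⟨not_lt.1 h1, not_lt.1 h2, hs.2⟩
  refine (lintegral_mono_set hsub).trans ((lintegral_union_le _ _ _).trans ?_)
  refine add_le_add ((lintegral_union_le _ _ _).trans (add_le_add ?_ ?_)) ?_
  · refine le_of_eq (setLIntegral_congr_fun measurableSet_Ioo fun s hs => ?_)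
    simp [hs.2]
  · rw [setLIntegral_congr (Ioi_ae_eq_Ici (a := T))]
    · refine le_trans (le_of_eq (setLIntegral_congr_fun (measurableSet_Ici.inter measurableSet_Iio)
        (g := w₂) fun s hs => ?_)) (lintegral_mono_set inter_subset_left)
      have h1 : T ≤ s := hs.1
      have h2 : s < S := hs.2
      simp [h1.not_gt, h2]
  · rw [setLIntegral_congr (Ioo_ae_eq_Ico (a := S) (b := t))]
    refine le_trans (le_of_eq (setLIntegral_congr_fun (measurableSet_Ici.inter measurableSet_Ico)
        (g := w₃) fun s hs => ?_)) (lintegral_mono_set inter_subset_right)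
    have h1 : T ≤ s := hs.1
    simp [h1.not_gt, hs.2.1.not_gt]

/-! ### Decay by a continuity argument -/

/-- The decay estimate at time `t` in the two endpoint norms, with constant `X`. -/
def DecayBound (r X : ℝ) (u : ℝ → Space n → ℝ) (t : ℝ) : Prop :=
  eLpNorm (u t) (ENNReal.ofReal r) volume ≤ ENNReal.ofReal X ∧
    eLpNorm (u t) ⊤ volume ≤ ENNReal.ofReal (X * t ^ (-((n : ℝ) / (2 * r))))

theorem DecayBound.mono {r X Y t : ℝ} {u : ℝ → Space n → ℝ} (h : DecayBound r X u t)
    (hXY : X ≤ Y) (ht : 0 < t) : DecayBound r Y u t := by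
  refine ⟨h.1.trans (ENNReal.ofReal_le_ofReal hXY), h.2.trans (ENNReal.ofReal_le_ofReal ?_)⟩
  gcongr

theorem DecayBound.eLpNorm_le {r X t : ℝ} {u : ℝ → Space n → ℝ} (h : DecayBound r X u t)
    (hr : 0 < r) (hX : 0 < X) (ht : 0 < t) {q : ℝ≥0∞} (hq : ENNReal.ofReal r ≤ q) :
    eLpNorm (u t) q volume ≤ ENNReal.ofReal (X * t ^ decayExponent n r q) := by
  refine (eLpNorm_le_rpow_mul_rpow_top hr hq hX (by positivity) h.1 h.2).trans (le_of_eq ?_)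
  rw [Real.mul_rpow hX.le (by positivity), ← Real.rpow_mul ht.le, ← mul_assoc, ← Real.rpow_add hX,
    add_sub_cancel, Real.rpow_one]
  congr 3
  unfold decayExponent
  field_simp

/-- The exponents `k` for which `f(u)` is controlled in `L^k` by the `exp L²` norm of `u`; they
start at the critical exponent and reach beyond `n / 2`. -/
def Admissible (n : ℕ) (k : ℝ) : Prop := 1 ≤ k ∧ 2 * n / (n + 4) ≤ k ∧ k ≤ n + 1

/-- The source term `f(u)` is bounded by `a`, uniformly in time, in every `L^k` with admissible
`k`. -/
def SourceBound (a : ℝ) (u : ℝ → Space n → ℝ) : Prop :=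
  ∀ s : ℝ, 0 < s → ∀ k : ℝ, Admissible n k →
    eLpNorm (fun y => nonlin n (u s y)) (ENNReal.ofReal k) volume ≤ ENNReal.ofReal a

theorem admissible_top (hn : 1 ≤ n) : Admissible n ((n : ℝ) + 1) := by
  have hn' : (1 : ℝ) ≤ n := by exact_mod_cast hn
  refine ⟨by linarith, ?_, le_rfl⟩
  rw [div_le_iff₀ (by linarith)]
  nlinarith

/-- Once `u` is at most `1`, the source term decays like `s^{-2/r}` in `L^r`, with `2 / r > 1`, and
with the additional factor `s^{-n/(2r)}` in `L^∞`. -/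
theorem DecayBound.nonlin_le (hn : 1 ≤ n) {r X s : ℝ} {u : ℝ → Space n → ℝ}
    (h : DecayBound r X u s) (hr : 0 < r) (hX : 0 < X) (hs : 0 < s)
    (hXs : X * s ^ (-((n : ℝ) / (2 * r))) ≤ 1) :
    eLpNorm (fun y => nonlin n (u s y)) (ENNReal.ofReal r) volume ≤
        ENNReal.ofReal (Real.exp 1 * X ^ (1 + 4 / (n : ℝ)) * s ^ (-(2 / r))) ∧
      eLpNorm (fun y => nonlin n (u s y)) ⊤ volume ≤
        ENNReal.ofReal (Real.exp 1 * X ^ (1 + 4 / (n : ℝ)) * s ^ (-(2 / r)) *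
          s ^ (-((n : ℝ) / (2 * r)))) := by
  have hn' : (0 : ℝ) < n := by exact_mod_cast hn
  have hb0 : 0 ≤ X * s ^ (-((n : ℝ) / (2 * r))) := by positivity
  have e : Real.exp 1 * (X * s ^ (-((n : ℝ) / (2 * r)))) ^ (4 / (n : ℝ)) * X =
      Real.exp 1 * X ^ (1 + 4 / (n : ℝ)) * s ^ (-(2 / r)) := by
    rw [Real.mul_rpow hX.le (by positivity), ← Real.rpow_mul hs.le, Real.rpow_add hX, Real.rpow_one]
    have : -((n : ℝ) / (2 * r)) * (4 / n) = -(2 / r) := by field_simp; norm_num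
    rw [this]; ring
  constructor
  · refine (eLpNorm_nonlin_le_of_eLpNorm_top_le hn hXs h.2 hb0 _).trans ?_
    refine (mul_le_mul' le_rfl h.1).trans (le_of_eq ?_)
    rw [← ENNReal.ofReal_mul (by positivity), e]
  · refine (eLpNorm_nonlin_le_of_eLpNorm_top_le hn hXs h.2 hb0 _).trans ?_
    refine (mul_le_mul' le_rfl h.2).trans (le_of_eq ?_)
    rw [← ENNReal.ofReal_mul (by positivity), ← mul_assoc, e]

theorem DecayBound.enorm_heat_nonlin_le (hn : 1 ≤ n) {r X s t : ℝ} {u : ℝ → Space n → ℝ}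
    (h : DecayBound r X u s) (hu : AEStronglyMeasurable (u s) volume) (hr : 1 ≤ r) (hX : 0 < X)
    (hs : 0 < s) (hst : s < t) (hXs : X * s ^ (-((n : ℝ) / (2 * r))) ≤ 1) (x : Space n) :
    ‖heat (t - s) (fun y => nonlin n (u s y)) x‖ₑ ≤
      ENNReal.ofReal ((t / 2) ^ (-((n : ℝ) / (2 * r))) *
        (Real.exp 1 * X ^ (1 + 4 / (n : ℝ))) * s ^ (-(2 / r))) := by
  have hr0 : 0 < r := by linarith
  have hτ : 0 < t - s := by linarith
  obtain ⟨h1, h2⟩ := h.nonlin_le hn hr0 hX hs hXs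
  have hα : -((n : ℝ) / (2 * r)) ≤ 0 := neg_nonpos.2 (by positivity)
  -- Before `t / 2` the heat semigroup smooths, after `t / 2` the source term itself is small.
  rcases le_total s (t / 2) with hst2 | hst2
  · refine (enorm_heat_le_rpow_mul hτ ((continuous_nonlin n).comp_aestronglyMeasurable hu)
      hr x).trans ?_
    refine (mul_le_mul' le_rfl h1).trans ?_
    rw [← ENNReal.ofReal_mul (by positivity), mul_assoc ((t / 2) ^ _)]
    refine ENNReal.ofReal_le_ofReal ?_
    gcongr ?_ * _
    exact Real.rpow_le_rpow_of_nonpos (by linarith) (by linarith) hα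
  · refine (enorm_heat_le_top hτ _ x).trans (h2.trans (ENNReal.ofReal_le_ofReal ?_))
    rw [mul_assoc ((t / 2) ^ _), mul_comm]
    gcongr ?_ * _
    exact Real.rpow_le_rpow_of_nonpos (by linarith) (by linarith) hα

section Bootstrap

variable {φ : Space n → ℝ} {u : ℝ → Space n → ℝ} {r a : ℝ}

theorem SourceBound.memLp (hs : SourceBound a u) (hu : IsMildSolution φ u) {s : ℝ} (hs0 : 0 < s)
    {k : ℝ} (hk : Admissible n k) :
    MemLp (fun y => nonlin n (u s y)) (ENNReal.ofReal k) volume :=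
  ⟨(continuous_nonlin n).comp_aestronglyMeasurable (hu.mem s hs0).aestronglyMeasurable,
    (hs s hs0 k hk).trans_lt ENNReal.ofReal_lt_top⟩

theorem SourceBound.enorm_heat_nonlin_le (hf : SourceBound a u) (hu : IsMildSolution φ u)
    {k s t : ℝ} (hk : Admissible n k) (hs : 0 < s) (hst : s < t) (x : Space n) :
    ‖heat (t - s) (fun y => nonlin n (u s y)) x‖ₑ ≤
      ENNReal.ofReal ((t - s) ^ (-((n : ℝ) / (2 * k))) * a) := by
  refine (enorm_heat_le_rpow_mul (sub_pos.2 hst) (hf.memLp hu hs hk).1 hk.1 x).trans ?_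
  rw [ENNReal.ofReal_mul (Real.rpow_nonneg (sub_pos.2 hst).le _)]
  exact mul_le_mul' le_rfl (hf s hs k hk)

theorem div_two_mul_add_one_le (n : ℕ) : (n : ℝ) / (2 * (n + 1)) ≤ 1 / 2 := by
  rw [div_le_div_iff₀ (by positivity) (by positivity)]
  linarith

/-- On a bounded time interval the decay estimate follows from smallness of the source term. -/
theorem DecayBound.of_le (hn : 1 ≤ n) (hu : IsMildSolution φ u) (hr : Admissible n r)
    (hφ : MemLp φ (ENNReal.ofReal r) volume) (ha : 0 < a) (hf : SourceBound a u) {m T₁ t : ℝ}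
    (hm : 0 < m) (hφm : eLpNorm φ (ENNReal.ofReal r) volume ≤ ENNReal.ofReal m)
    (h1 : a * T₁ ≤ m)
    (h2 : 2 * a * T₁ ^ (1 - (n : ℝ) / (2 * (n + 1)) + n / (2 * r)) ≤ m)
    (ht : 0 < t) (htT : t ≤ T₁) : DecayBound r (2 * m) u t := by
  have hr0 : 0 < r := by linarith [hr.1]
  have hβ := div_two_mul_add_one_le n
  constructor
  · refine (hu.eLpNorm_le ht hr.1 hφ (fun s hs => hf.memLp hu hs.1 hr) (w := fun _ => a)
      measurable_const (fun _ _ => ha) fun s hs => ?_).trans ?_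
    · exact (eLpNorm_heat_le (sub_pos.2 hs.2) (hf.memLp hu hs.1 hr).1 hr.1).trans (hf s hs.1 r hr)
    · rw [setLIntegral_const, Real.volume_Ioo, sub_zero, ← ENNReal.ofReal_mul ha.le, two_mul,
        ENNReal.ofReal_add hm.le hm.le]
      refine add_le_add ((eLpNorm_heat_le ht hφ.1 hr.1).trans hφm) (ENNReal.ofReal_le_ofReal ?_)
      nlinarith
  · refine (hu.eLpNorm_top_le ht
      (A := ENNReal.ofReal (t ^ (-((n : ℝ) / (2 * r))) * m)) (fun x => ?_)
      (w := fun s => (t - s) ^ (-((n : ℝ) / (2 * (n + 1)))) * a) fun s hs x => ?_).trans ?_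
    · refine (enorm_heat_le_rpow_mul ht hφ.1 hr.1 x).trans ?_
      rw [ENNReal.ofReal_mul (by positivity)]
      exact mul_le_mul' le_rfl hφm
    · exact hf.enorm_heat_nonlin_le hu (admissible_top hn) hs.1 hs.2 x
    · refine (add_le_add le_rfl (lintegral_Ioo_rpow_sub_le ha.le hβ ht.le)).trans ?_
      rw [← ENNReal.ofReal_add (by positivity) (by rw [sub_zero]; positivity), sub_zero]
      refine ENNReal.ofReal_le_ofReal ?_
      have e : t ^ (1 - (n : ℝ) / (2 * (n + 1))) = t ^ (-((n : ℝ) / (2 * r))) *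
          t ^ (1 - (n : ℝ) / (2 * (n + 1)) + n / (2 * r)) := by
        rw [← Real.rpow_add ht]; congr 1; ring
      have h3 : t ^ (1 - (n : ℝ) / (2 * (n + 1)) + n / (2 * r)) ≤
          T₁ ^ (1 - (n : ℝ) / (2 * (n + 1)) + n / (2 * r)) := by
        refine Real.rpow_le_rpow ht.le htT ?_
        have : 0 ≤ (n : ℝ) / (2 * r) := by positivity
        linarith
      have h4 : 2 * a * t ^ (1 - (n : ℝ) / (2 * (n + 1)) + n / (2 * r)) ≤ m :=
        le_trans (by gcongr) h2
      have h5 : 0 ≤ t ^ (-((n : ℝ) / (2 * r))) := by positivity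
      rw [e]
      nlinarith

/-- The nonlinear part of Duhamel's formula at a late time `t`, when the decay estimate is known on
`[T, S)`. The contribution of `(0, T)` is estimated in some `L^l` with `l ≤ r`, that of `[T, S)` by
the decay of the source term, and that of `[S, t)` only by the boundedness of the source term. -/
theorem duhamel_le_of_decayBound (hn : 1 ≤ n) (hu : IsMildSolution φ u) (hr : Admissible n r)
    (hr2 : r < 2) (hφ : MemLp φ (ENNReal.ofReal r) volume) (ha : 0 < a) (hf : SourceBound a u)
    {l X T S t : ℝ} (hl : Admissible n l) (hlr : l ≤ r) (hX : 0 < X) (hT : 0 < T) (hTt : 2 * T ≤ t)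
    (hSt : S ≤ t) (hXT : X * T ^ (-((n : ℝ) / (2 * r))) ≤ 1)
    (hdec : ∀ s, T ≤ s → s < S → DecayBound r X u s) :
    (eLpNorm (u t) (ENNReal.ofReal r) volume ≤
      eLpNorm (heat t φ) (ENNReal.ofReal r) volume +
        ENNReal.ofReal ((t / 2) ^ (-((n : ℝ) / 2 * (1 / l - 1 / r))) * a * T +
          Real.exp 1 * X ^ (1 + 4 / (n : ℝ)) * (T ^ (1 - 2 / r) / (2 / r - 1)) + a * (t - S))) ∧
    ∀ A : ℝ≥0∞, (∀ x, ‖heat t φ x‖ₑ ≤ A) → eLpNorm (u t) ⊤ volume ≤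
      A + ENNReal.ofReal ((t / 2) ^ (-((n : ℝ) / (2 * l))) * a * T +
        (t / 2) ^ (-((n : ℝ) / (2 * r))) * (Real.exp 1 * X ^ (1 + 4 / (n : ℝ)) *
          (T ^ (1 - 2 / r) / (2 / r - 1))) +
        2 * a * (t - S) ^ (1 - (n : ℝ) / (2 * (n + 1)))) := by
  have hr0 : 0 < r := by linarith [hr.1]
  have hl0 : 0 < l := by linarith [hl.1]
  have ht : 0 < t := by linarith
  have hρ : 1 < 2 / r := by rwa [one_lt_div hr0]
  have hρ' : 0 < 2 / r - 1 := by linarith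
  have hβ := div_two_mul_add_one_le n
  set c : ℝ := Real.exp 1 * X ^ (1 + 4 / (n : ℝ)) with hc
  have hc0 : 0 < c := by positivity
  have htS : 0 ≤ t - S := by linarith
  have hXs : ∀ s, T ≤ s → X * s ^ (-((n : ℝ) / (2 * r))) ≤ 1 := by
    intro s hs
    refine le_trans ?_ hXT
    gcongr ?_ * ?_
    exact Real.rpow_le_rpow_of_nonpos hT hs (neg_nonpos.2 (by positivity))
  have hhalf : ∀ s κ : ℝ, s < T → 0 ≤ κ → (t - s) ^ (-κ) ≤ (t / 2) ^ (-κ) := fun s κ hs hκ =>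
    Real.rpow_le_rpow_of_nonpos (by linarith) (by linarith) (neg_nonpos.2 hκ)
  have hκ : 0 ≤ (n : ℝ) / 2 * (1 / l - 1 / r) := by
    have := one_div_le_one_div_of_le hl0 hlr
    have : 0 ≤ 1 / l - 1 / r := by linarith
    positivity
  have hofite : ∀ (w₁ w₂ w₃ : ℝ → ℝ) (s : ℝ),
      ENNReal.ofReal (if s < T then w₁ s else if s < S then w₂ s else w₃ s) =
        if s < T then ENNReal.ofReal (w₁ s) else
          if s < S then ENNReal.ofReal (w₂ s) else ENNReal.ofReal (w₃ s) := by
    intro w₁ w₂ w₃ s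
    split_ifs <;> rfl
  constructor
  · set κ := (n : ℝ) / 2 * (1 / l - 1 / r) with hκdef
    refine (hu.eLpNorm_le ht hr.1 hφ (fun s hs => hf.memLp hu hs.1 hr)
      (w := fun s => if s < T then (t / 2) ^ (-κ) * a else if s < S then c * s ^ (-(2 / r)) else a)
      ?_ ?_ ?_).trans (add_le_add le_rfl ?_)
    · refine Measurable.ite measurableSet_Iio measurable_const
        (Measurable.ite measurableSet_Iio ?_ measurable_const)
      fun_prop
    · intro s hs
      have := hs.1
      split_ifs <;> positivity
    · intro s hs
      have hm := (hf.memLp hu hs.1 hr).1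
      have hτ := sub_pos.2 hs.2
      split_ifs with h1 h2
      · refine (eLpNorm_heat_le_rpow_mul hτ hm hl.1 hlr ha (hf s hs.1 l hl)).trans
          (ENNReal.ofReal_le_ofReal ?_)
        exact mul_le_mul_of_nonneg_right (hhalf s κ h1 hκ) ha.le
      · exact (eLpNorm_heat_le hτ hm hr.1).trans
          ((hdec s (not_lt.1 h1) h2).nonlin_le hn hr0 hX hs.1 (hXs s (not_lt.1 h1))).1
      · exact (eLpNorm_heat_le hτ hm hr.1).trans (hf s hs.1 r hr)
    · simp only [hofite (fun _ => (t / 2) ^ (-κ) * a) (fun s => c * s ^ (-(2 / r))) (fun _ => a)]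
      refine (lintegral_Ioo_ite_le _ _ _).trans ?_
      rw [ENNReal.ofReal_add (by positivity) (by positivity),
        ENNReal.ofReal_add (by positivity) (by positivity)]
      refine add_le_add (add_le_add ?_ (lintegral_Ioi_rpow_le hc0.le hρ hT)) ?_
      · rw [setLIntegral_const, Real.volume_Ioo, sub_zero, ← ENNReal.ofReal_mul (by positivity)]
      · rw [setLIntegral_const, Real.volume_Ioo, ← ENNReal.ofReal_mul ha.le]
  · intro A hA
    refine (hu.eLpNorm_top_le ht hA
      (w := fun s => if s < T then (t / 2) ^ (-((n : ℝ) / (2 * l))) * a else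
        if s < S then (t / 2) ^ (-((n : ℝ) / (2 * r))) * c * s ^ (-(2 / r)) else
          (t - s) ^ (-((n : ℝ) / (2 * (n + 1)))) * a) ?_).trans (add_le_add le_rfl ?_)
    · intro s hs x
      split_ifs with h1 h2
      · refine (hf.enorm_heat_nonlin_le hu hl hs.1 hs.2 x).trans (ENNReal.ofReal_le_ofReal ?_)
        exact mul_le_mul_of_nonneg_right (hhalf s _ h1 (by positivity)) ha.le
      · exact (hdec s (not_lt.1 h1) h2).enorm_heat_nonlin_le hn
          (hu.mem s hs.1).aestronglyMeasurable hr.1 hX hs.1 hs.2 (hXs s (not_lt.1 h1)) x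
      · exact hf.enorm_heat_nonlin_le hu (admissible_top hn) hs.1 hs.2 x
    · simp only [hofite (fun _ => (t / 2) ^ (-((n : ℝ) / (2 * l))) * a)
        (fun s => (t / 2) ^ (-((n : ℝ) / (2 * r))) * c * s ^ (-(2 / r)))
        (fun s => (t - s) ^ (-((n : ℝ) / (2 * (n + 1)))) * a)]
      refine (lintegral_Ioo_ite_le _ _ _).trans ?_
      rw [ENNReal.ofReal_add (by positivity) (by positivity),
        ENNReal.ofReal_add (by positivity) (by positivity)]
      refine add_le_add (add_le_add ?_ ?_) (lintegral_Ioo_rpow_sub_le ha.le hβ hSt)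
      · rw [setLIntegral_const, Real.volume_Ioo, sub_zero, ← ENNReal.ofReal_mul (by positivity)]
      · have hzc : 0 ≤ (t / 2) ^ (-((n : ℝ) / (2 * r))) * c := by positivity
        exact (lintegral_Ioi_rpow_le hzc hρ hT).trans_eq (by rw [mul_assoc])

/-- The constant in the decay estimate. -/
noncomputable def decayConst (n : ℕ) : ℝ := 2 + 2 * 2 ^ ((n : ℝ) / 2)

theorem decayConst_ge (n : ℕ) : 4 ≤ decayConst n := by
  have : (1 : ℝ) ≤ 2 ^ ((n : ℝ) / 2) := Real.one_le_rpow one_le_two (by positivity)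
  unfold decayConst; linarith

theorem half_rpow_le {t : ℝ} (ht : 0 < t) (hr : 1 ≤ r) :
    (t / 2) ^ (-((n : ℝ) / (2 * r))) ≤ 2 ^ ((n : ℝ) / 2) * t ^ (-((n : ℝ) / (2 * r))) := by
  rw [Real.div_rpow ht.le zero_le_two, Real.rpow_neg zero_le_two, div_inv_eq_mul, mul_comm]
  gcongr
  · exact one_le_two
  · linarith

/-- The decay estimate for all times. It holds up to time `2 T` by smallness of the source term;
if it holds before some later time `S`, then it holds shortly after `S`, since the source term on
`[S, t)` contributes little when `t` is close to `S`. -/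
theorem decayBound_of_sourceBound (hn : 1 ≤ n) (hu : IsMildSolution φ u) (hr : Admissible n r)
    (hr2 : r < 2) (hφ : MemLp φ (ENNReal.ofReal r) volume) (ha : 0 < a) (hf : SourceBound a u)
    {m T : ℝ} (hm : 0 < m) (hφm : eLpNorm φ (ENNReal.ofReal r) volume ≤ ENNReal.ofReal m)
    (hT : 0 < T) (hXT : decayConst n * m * T ^ (-((n : ℝ) / (2 * r))) ≤ 1)
    (htail : Real.exp 1 * (decayConst n * m) ^ (1 + 4 / (n : ℝ)) *
      (T ^ (1 - 2 / r) / (2 / r - 1)) ≤ m / 2)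
    (h1 : a * (2 * T) ≤ m)
    (h2 : 2 * a * (2 * T) ^ (1 - (n : ℝ) / (2 * (n + 1)) + n / (2 * r)) ≤ m) {t : ℝ}
    (ht : 0 < t) : DecayBound r (decayConst n * m) u t := by
  have hr0 : 0 < r := by linarith [hr.1]
  have hC := decayConst_ge n
  have hβ := div_two_mul_add_one_le n
  have hX : 0 < decayConst n * m := by positivity
  have hbase : ∀ t, 0 < t → t ≤ 2 * T → DecayBound r (decayConst n * m) u t := fun t ht htT =>
    (DecayBound.of_le hn hu hr hφ ha hf hm hφm h1 h2 ht htT).mono (by nlinarith) ht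
  by_contra hcon
  set bad : Set ℝ := {t | 0 < t ∧ ¬ DecayBound r (decayConst n * m) u t} with hbad
  have hne : bad.Nonempty := ⟨t, ht, hcon⟩
  have hlb : ∀ t ∈ bad, 2 * T ≤ t := by
    intro t ht
    by_contra h
    exact ht.2 (hbase t ht.1 (not_le.1 h).le)
  set S := sInf bad with hS
  have hTS : 2 * T ≤ S := le_csInf hne hlb
  have hbelow : ∀ s, 0 < s → s < S → DecayBound r (decayConst n * m) u s := by
    intro s hs hsS
    by_contra h
    exact absurd (csInf_le ⟨_, hlb⟩ (show s ∈ bad from ⟨hs, h⟩)) (not_le.2 hsS)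
  -- A step size for which the source term on `[S, S + δ)` is negligible.
  obtain ⟨δ, hδ0, hδ1, hδa, hδb⟩ : ∃ δ : ℝ, 0 < δ ∧ δ ≤ 1 ∧ a * δ ≤ m ∧
      2 * a * δ ^ (1 - (n : ℝ) / (2 * (n + 1))) ≤ m * (S + 1) ^ (-((n : ℝ) / (2 * r))) := by
    have hSpos : 0 < S + 1 := by linarith
    have e1 : ∀ᶠ δ : ℝ in 𝓝[>] 0, a * δ < m := by
      have : Tendsto (fun δ : ℝ => a * δ) (𝓝[>] 0) (𝓝 (a * 0)) :=
        tendsto_nhdsWithin_of_tendsto_nhds (Continuous.tendsto (by fun_prop) _)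
      exact this.eventually (gt_mem_nhds (by simpa using hm))
    have e2 : ∀ᶠ δ : ℝ in 𝓝[>] 0, 2 * a * δ ^ (1 - (n : ℝ) / (2 * (n + 1))) <
        m * (S + 1) ^ (-((n : ℝ) / (2 * r))) := by
      have : Tendsto (fun δ : ℝ => 2 * a * δ ^ (1 - (n : ℝ) / (2 * (n + 1)))) (𝓝[>] 0)
          (𝓝 (2 * a * 0 ^ (1 - (n : ℝ) / (2 * (n + 1))))) :=
        tendsto_nhdsWithin_of_tendsto_nhds
          (((Real.continuous_rpow_const (by linarith)).const_mul _).tendsto 0)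
      refine this.eventually (gt_mem_nhds ?_)
      rw [Real.zero_rpow (by linarith), mul_zero]
      positivity
    have e3 : ∀ᶠ δ : ℝ in 𝓝[>] 0, δ ∈ Ioc 0 1 := Ioc_mem_nhdsGT one_pos
    obtain ⟨δ, h1, h2, h3⟩ := (e1.and (e2.and e3)).exists
    exact ⟨δ, h3.1, h3.2, h1.le, h2.le⟩
  obtain ⟨t, htbad, htS⟩ := exists_lt_of_csInf_lt hne (lt_add_of_pos_right S hδ0)
  have hSt : S ≤ t := csInf_le ⟨_, hlb⟩ htbad
  have ht0 := htbad.1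
  refine htbad.2 ?_
  obtain ⟨hA, hB⟩ := duhamel_le_of_decayBound hn hu hr hr2 hφ ha hf hr le_rfl hX hT
    (hTS.trans hSt) hSt hXT fun s hs hsS => hbelow s (hT.trans_le hs) hsS
  have h5 : 0 < t ^ (-((n : ℝ) / (2 * r))) := by positivity
  have hts : 0 ≤ t - S := by linarith
  constructor
  · refine hA.trans ((add_le_add ((eLpNorm_heat_le ht0 hφ.1 hr.1).trans hφm) le_rfl).trans ?_)
    rw [sub_self, mul_zero, neg_zero, Real.rpow_zero, one_mul]
    have hδ' : a * (t - S) ≤ a * δ := by gcongr; linarith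
    calc _ ≤ ENNReal.ofReal m + ENNReal.ofReal (2 * m) := by
          gcongr
          linarith
      _ = ENNReal.ofReal (m + 2 * m) := (ENNReal.ofReal_add hm.le (by linarith)).symm
      _ ≤ _ := ENNReal.ofReal_le_ofReal (by nlinarith)
  · have hA' : ∀ x, ‖heat t φ x‖ₑ ≤ ENNReal.ofReal (t ^ (-((n : ℝ) / (2 * r))) * m) := by
      intro x
      refine (enorm_heat_le_rpow_mul ht0 hφ.1 hr.1 x).trans ?_
      rw [ENNReal.ofReal_mul (by positivity)]
      exact mul_le_mul' le_rfl hφm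
    refine (hB _ hA').trans ?_
    have hδ' : 2 * a * (t - S) ^ (1 - (n : ℝ) / (2 * (n + 1))) ≤
        m * t ^ (-((n : ℝ) / (2 * r))) := by
      calc _ ≤ 2 * a * δ ^ (1 - (n : ℝ) / (2 * (n + 1))) := by
            gcongr
            · linarith
            · linarith
        _ ≤ m * (S + 1) ^ (-((n : ℝ) / (2 * r))) := hδb
        _ ≤ _ := by
            gcongr ?_ * ?_
            exact Real.rpow_le_rpow_of_nonpos ht0 (by linarith) (neg_nonpos.2 (by positivity))
    have hhalf := half_rpow_le (n := n) ht0 hr.1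
    set y := t ^ (-((n : ℝ) / (2 * r))) with hy
    set z := (t / 2) ^ (-((n : ℝ) / (2 * r))) with hz
    have hz0 : 0 ≤ z := by positivity
    calc _ ≤ ENNReal.ofReal (y * m) +
          ENNReal.ofReal (2 ^ ((n : ℝ) / 2) * y * m + m * y) := by
          refine add_le_add le_rfl (ENNReal.ofReal_le_ofReal ?_)
          have i1 := mul_le_mul_of_nonneg_left htail hz0
          have i2 : z * (a * T + m / 2) ≤ 2 ^ ((n : ℝ) / 2) * y * m :=
            mul_le_mul hhalf (by linarith) (by positivity) (by positivity)
          linarith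
      _ = ENNReal.ofReal (y * m + (2 ^ ((n : ℝ) / 2) * y * m + m * y)) :=
          (ENNReal.ofReal_add (by positivity) (by positivity)).symm
      _ ≤ _ := by
          refine ENNReal.ofReal_le_ofReal ?_
          unfold decayConst
          have : 0 ≤ 2 ^ ((n : ℝ) / 2) * y * m := by positivity
          linarith

end Bootstrap

/-! ### Choice of the time scale and of the smallness threshold -/

theorem exists_time_scale (hn : 1 ≤ n) {r : ℝ} (hr0 : 0 < r) (hr2 : r < 2) (X c : ℝ) {η : ℝ}
    (hη : 0 < η) :
    ∃ T : ℝ, 0 < T ∧ X * T ^ (-((n : ℝ) / (2 * r))) ≤ 1 ∧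
      c * (T ^ (1 - 2 / r) / (2 / r - 1)) ≤ η := by
  have hn' : (0 : ℝ) < n := by exact_mod_cast hn
  have hρ : 0 < 2 / r - 1 := sub_pos.2 ((one_lt_div hr0).2 hr2)
  have t1 : Tendsto (fun T : ℝ => X * T ^ (-((n : ℝ) / (2 * r)))) atTop (𝓝 (X * 0)) :=
    (tendsto_rpow_neg_atTop (by positivity)).const_mul X
  have t2 : Tendsto (fun T : ℝ => c * (T ^ (1 - 2 / r) / (2 / r - 1))) atTop
      (𝓝 (c * (0 / (2 / r - 1)))) := by
    have := tendsto_rpow_neg_atTop hρ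
    rw [neg_sub] at this
    exact (this.div_const _).const_mul c
  have e1 := t1.eventually (gt_mem_nhds (show X * 0 < 1 by simp))
  have e2 := t2.eventually (gt_mem_nhds (show c * (0 / (2 / r - 1)) < η by simpa using hη))
  obtain ⟨T, h1, h2, h3⟩ := (e1.and (e2.and (eventually_gt_atTop 0))).exists
  exact ⟨T, h3, h1.le, h2.le⟩

/-- The bound of the source term in terms of the `exp L²` norm `M` of the initial value. The factor
`3` rather than `2` makes `3 M` exceed the norm of `u(t)` strictly, so that the modular of `u(t)` at
`3 M` is at most `1`. -/
noncomputable def sourceConst (n : ℕ) (M : ℝ) : ℝ :=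
  nonlinConst n * (3 * M) ^ (1 + 4 / (n : ℝ))

/-- A time scale `T` and a threshold `δ` for `M`, depending on `n`, `r` and `N` only, for which the
smallness conditions of the continuity argument hold. -/
theorem exists_threshold (hn : 1 ≤ n) {r : ℝ} (hr0 : 0 < r) (hr2 : r < 2) (N : ℝ) :
    ∃ T δ : ℝ, 0 < T ∧ 0 < δ ∧ ∀ M : ℝ, 0 < M → M < 1 → M < δ →
      decayConst n * max M N * T ^ (-((n : ℝ) / (2 * r))) ≤ 1 ∧
      Real.exp 1 * (decayConst n * max M N) ^ (1 + 4 / (n : ℝ)) *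
        (T ^ (1 - 2 / r) / (2 / r - 1)) ≤ max M N / 2 ∧
      sourceConst n M * (2 * T) ≤ max M N ∧
      2 * sourceConst n M * (2 * T) ^ (1 - (n : ℝ) / (2 * (n + 1)) + n / (2 * r)) ≤ max M N := by
  have hn' : (0 : ℝ) < n := by exact_mod_cast hn
  have hC := decayConst_ge n
  have hK := two_le_nonlinConst n
  have hρ : 0 < 2 / r - 1 := sub_pos.2 ((one_lt_div hr0).2 hr2)
  set σ : ℝ := 4 / (n : ℝ) with hσ
  have hσ0 : 0 < σ := by positivity
  set m₀ := max 1 N with hm₀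
  have hm₀1 : 1 ≤ m₀ := le_max_left _ _
  obtain ⟨T, hT, hT1, hT2⟩ := exists_time_scale hn hr0 hr2 (decayConst n * m₀)
    (Real.exp 1 * decayConst n ^ (1 + σ) * m₀ ^ σ) one_half_pos
  set E := max (2 * T) (2 * (2 * T) ^ (1 - (n : ℝ) / (2 * (n + 1)) + n / (2 * r))) with hE
  have hsmall : ∀ᶠ M : ℝ in 𝓝[>] 0, nonlinConst n * 3 ^ (1 + σ) * M ^ σ * E < 1 := by
    have : Tendsto (fun M : ℝ => nonlinConst n * 3 ^ (1 + σ) * M ^ σ * E) (𝓝[>] 0)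
        (𝓝 (nonlinConst n * 3 ^ (1 + σ) * 0 ^ σ * E)) :=
      tendsto_nhdsWithin_of_tendsto_nhds
        ((((Real.continuous_rpow_const hσ0.le).const_mul _).mul_const _).tendsto 0)
    refine this.eventually (gt_mem_nhds ?_)
    rw [Real.zero_rpow hσ0.ne']; simp
  obtain ⟨δ, hδ, hδM⟩ := mem_nhdsGT_iff_exists_Ioo_subset.1 hsmall
  refine ⟨T, δ, hT, hδ, fun M hM hM1 hMδ => ?_⟩
  have hMs : nonlinConst n * 3 ^ (1 + σ) * M ^ σ * E < 1 := hδM ⟨hM, hMδ⟩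
  set m := max M N with hm
  have hMm : M ≤ m := le_max_left _ _
  have hm0 : 0 < m := hM.trans_le hMm
  have hmm₀ : m ≤ m₀ := max_le_max hM1.le le_rfl
  have hsc : sourceConst n M * E ≤ m := by
    have e : sourceConst n M * E = M * (nonlinConst n * 3 ^ (1 + σ) * M ^ σ * E) := by
      unfold sourceConst
      rw [Real.mul_rpow zero_le_three hM.le, Real.rpow_add hM, Real.rpow_one]
      ring
    rw [e]
    nlinarith
  have hsc0 : 0 ≤ sourceConst n M := by unfold sourceConst; positivity
  refine ⟨?_, ?_, ?_, ?_⟩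
  · refine le_trans ?_ hT1
    gcongr
  · calc Real.exp 1 * (decayConst n * m) ^ (1 + σ) * (T ^ (1 - 2 / r) / (2 / r - 1))
        = m * (Real.exp 1 * decayConst n ^ (1 + σ) * m ^ σ *
            (T ^ (1 - 2 / r) / (2 / r - 1))) := by
          rw [Real.mul_rpow (by linarith) hm0.le, Real.rpow_add hm0, Real.rpow_one]
          ring
      _ ≤ m * (Real.exp 1 * decayConst n ^ (1 + σ) * m₀ ^ σ *
            (T ^ (1 - 2 / r) / (2 / r - 1))) := by gcongr
      _ ≤ m * (1 / 2) := by gcongr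
      _ = m / 2 := by ring
  · exact (mul_le_mul_of_nonneg_left (le_max_left _ _) hsc0).trans hsc
  · rw [mul_comm 2, mul_assoc]
    exact (mul_le_mul_of_nonneg_left (le_max_right _ _) hsc0).trans hsc

/-! ### Improved decay as time tends to infinity -/

/-- If the source term is also bounded in some `L^l` with `l < r`, then the decay estimate holds
with arbitrarily small constants for large times. Up to a small error the initial value lies in
`L^l` as well, so both parts of Duhamel's formula gain a negative power of time, up to the tail
`∫_T^∞ s^{-2/r} ds`. -/
theorem eventually_decayBound (hn : 1 ≤ n) {φ : Space n → ℝ} {u : ℝ → Space n → ℝ} {r l a X : ℝ}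
    (hu : IsMildSolution φ u) (hr : Admissible n r) (hr2 : r < 2)
    (hφ : MemLp φ (ENNReal.ofReal r) volume) (ha : 0 < a) (hf : SourceBound a u)
    (hl : Admissible n l) (hlr : l < r) (hX : 0 < X)
    (hdec : ∀ t, 0 < t → DecayBound r X u t) {η : ℝ} (hη : 0 < η) :
    ∀ᶠ t in atTop, DecayBound r η u t := by
  have hn' : (0 : ℝ) < n := by exact_mod_cast hn
  have hr0 : 0 < r := by linarith [hr.1]
  have hl0 : 0 < l := by linarith [hl.1]
  have hβ := div_two_mul_add_one_le n
  have hη4 : 0 < η / 4 := by positivity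
  set κ := (n : ℝ) / 2 * (1 / l - 1 / r) with hκdef
  have hκ : 0 < κ := by
    have := one_div_lt_one_div_of_lt hl0 hlr
    have : 0 < 1 / l - 1 / r := by linarith
    positivity
  have hακ : -((n : ℝ) / (2 * l)) = -((n : ℝ) / (2 * r)) + -κ := by
    rw [hκdef]; field_simp; ring
  set D : ℝ := 2 ^ ((n : ℝ) / 2) with hD
  have hD1 : 1 ≤ D := Real.one_le_rpow one_le_two (by positivity)
  obtain ⟨g, hgc, hgφ, hgcont, hgr⟩ := hφ.exists_hasCompactSupport_eLpNorm_sub_le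
    ENNReal.ofReal_ne_top (ε := ENNReal.ofReal (η / 4)) (by simpa using hη4)
  have hgl : MemLp g (ENNReal.ofReal l) volume := hgcont.memLp_of_hasCompactSupport hgc
  have hφg : MemLp (φ - g) (ENNReal.ofReal r) volume := hφ.sub hgr
  set B := (eLpNorm g (ENNReal.ofReal l) volume).toReal + 1 with hB
  have hB0 : 0 < B := by positivity
  have hgB : eLpNorm g (ENNReal.ofReal l) volume ≤ ENNReal.ofReal B := by
    rw [← ENNReal.ofReal_toReal hgl.2.ne]
    exact ENNReal.ofReal_le_ofReal (by rw [hB]; linarith)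
  obtain ⟨T, hT, hT1, hT2⟩ := exists_time_scale hn hr0 hr2 X
    (Real.exp 1 * X ^ (1 + 4 / (n : ℝ))) (η := η / 4 / D) (by positivity)
  set c := Real.exp 1 * X ^ (1 + 4 / (n : ℝ)) * (T ^ (1 - 2 / r) / (2 / r - 1)) with hc
  have hDc : D * c ≤ η / 4 := by
    rw [le_div_iff₀ (by positivity)] at hT2; linarith
  have e1 : ∀ᶠ t : ℝ in atTop, t ^ (-κ) * B < η / 4 := by
    have : Tendsto (fun t : ℝ => t ^ (-κ) * B) atTop (𝓝 (0 * B)) :=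
      (tendsto_rpow_neg_atTop hκ).mul_const B
    exact this.eventually (gt_mem_nhds (by simpa using hη4))
  have e2 : ∀ᶠ t : ℝ in atTop, (t / 2) ^ (-κ) * (D * (a * T)) < η / 4 := by
    have : Tendsto (fun t : ℝ => (t / 2) ^ (-κ) * (D * (a * T))) atTop (𝓝 (0 * (D * (a * T)))) :=
      ((tendsto_rpow_neg_atTop hκ).comp (tendsto_id.atTop_div_const two_pos)).mul_const _
    exact this.eventually (gt_mem_nhds (by simpa using hη4))
  filter_upwards [e1, e2, eventually_ge_atTop (2 * T)] with t h1 h2 hTt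
  have ht : 0 < t := by linarith
  obtain ⟨hA, hB⟩ := duhamel_le_of_decayBound hn hu hr hr2 hφ ha hf hl hlr.le hX hT hTt le_rfl hT1
    fun s hs _ => hdec s (hT.trans_le hs)
  rw [← hc] at hA hB
  have hsplit : heat t φ = heat t (φ - g) + heat t g := by
    rw [← heat_add ht hr.1 hl.1 hφg hgl, sub_add_cancel]
  set y := t ^ (-((n : ℝ) / (2 * r))) with hy
  have hy0 : 0 < y := by positivity
  set z := (t / 2) ^ (-κ) with hz
  have hz0 : 0 < z := by positivity
  constructor
  · have hlin : eLpNorm (heat t φ) (ENNReal.ofReal r) volume ≤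
        ENNReal.ofReal (η / 4 + t ^ (-κ) * B) := by
      rw [hsplit, ENNReal.ofReal_add hη4.le (by positivity)]
      refine (eLpNorm_add_le (continuous_heat ht hr.1 hφg).aestronglyMeasurable
        (continuous_heat ht hl.1 hgl).aestronglyMeasurable (by simpa using hr.1)).trans ?_
      exact add_le_add ((eLpNorm_heat_le ht hφg.1 hr.1).trans hgφ)
        (eLpNorm_heat_le_rpow_mul ht hgl.1 hl.1 hlr.le hB0 hgB)
    have hzaT : z * a * T ≤ η / 4 := by
      have : z * (a * T) * 1 ≤ z * (a * T) * D := by gcongr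
      linarith
    have hcη : c ≤ η / 4 := by
      rcases le_total c 0 with h | h
      · linarith
      · nlinarith
    refine hA.trans ((add_le_add hlin (ENNReal.ofReal_le_ofReal
      (show z * a * T + c + a * (t - t) ≤ η / 4 + η / 4 by linarith))).trans ?_)
    rw [← ENNReal.ofReal_add (by positivity) (by positivity)]
    exact ENNReal.ofReal_le_ofReal (by linarith)
  · have hlin : ∀ x, ‖heat t φ x‖ₑ ≤ ENNReal.ofReal (y * (η / 4) + y * (t ^ (-κ) * B)) := by
      intro x
      rw [hsplit, ENNReal.ofReal_add (by positivity) (by positivity)]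
      refine (enorm_add_le _ _).trans (add_le_add ?_ ?_)
      · refine (enorm_heat_le_rpow_mul ht hφg.1 hr.1 x).trans ?_
        rw [ENNReal.ofReal_mul hy0.le]
        exact mul_le_mul' le_rfl hgφ
      · refine (enorm_heat_le_rpow_mul ht hgl.1 hl.1 x).trans ?_
        rw [← mul_assoc, hy, ← Real.rpow_add ht, ← hακ, ENNReal.ofReal_mul (by positivity)]
        exact mul_le_mul' le_rfl hgB
    have hhalf : (t / 2) ^ (-((n : ℝ) / (2 * r))) ≤ D * y := half_rpow_le ht hr.1
    have hhalf0 : 0 < (t / 2) ^ (-((n : ℝ) / (2 * r))) := by positivity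
    have hrest : (t / 2) ^ (-((n : ℝ) / (2 * l))) * a * T + (t / 2) ^ (-((n : ℝ) / (2 * r))) * c +
        2 * a * (t - t) ^ (1 - (n : ℝ) / (2 * (n + 1))) ≤ y * (η / 4) + y * (η / 4) := by
      rw [sub_self, Real.zero_rpow (by linarith), mul_zero, add_zero, hακ,
        Real.rpow_add (by positivity), ← hz]
      refine add_le_add ?_ ?_
      · calc _ = (t / 2) ^ (-((n : ℝ) / (2 * r))) * (z * (a * T)) := by ring
          _ ≤ D * y * (z * (a * T)) := by gcongr
          _ = y * (z * (D * (a * T))) := by ring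
          _ ≤ _ := by gcongr
      · rcases le_total c 0 with h | h
        · have := mul_nonpos_of_nonneg_of_nonpos hhalf0.le h
          have : 0 < y * (η / 4) := by positivity
          linarith
        · calc _ ≤ D * y * c := by gcongr
            _ = y * (D * c) := by ring
            _ ≤ _ := by gcongr
    refine (hB _ hlin).trans ((add_le_add le_rfl (ENNReal.ofReal_le_ofReal hrest)).trans ?_)
    rw [← ENNReal.ofReal_add (by positivity) (by positivity)]
    refine ENNReal.ofReal_le_ofReal ?_
    have := mul_le_mul_of_nonneg_left h1.le hy0.le
    linarith

theorem isLittleO_of_eventually_decayBound {u : ℝ → Space n → ℝ} {r : ℝ} (hr : 0 < r)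
    (h : ∀ η : ℝ, 0 < η → ∀ᶠ t in atTop, DecayBound r η u t) {q : ℝ≥0∞}
    (hq : ENNReal.ofReal r ≤ q) :
    (fun t : ℝ => (eLpNorm (u t) q volume).toReal) =o[atTop]
      fun t : ℝ => t ^ decayExponent n r q := by
  rw [isLittleO_iff]
  intro c hc
  filter_upwards [h c hc, eventually_gt_atTop 0] with t ht ht0
  rw [Real.norm_of_nonneg ENNReal.toReal_nonneg, Real.norm_of_nonneg (by positivity)]
  exact ENNReal.toReal_le_of_le_ofReal (by positivity) (ht.eLpNorm_le hr hc ht0 hq)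

/-! ### Smallness of the solution -/

theorem admissible_of_le_of_lt_two (hn : 1 ≤ n) {k : ℝ} (h1 : 1 ≤ k) (h2 : 2 * n / (n + 4) ≤ k)
    (h3 : k < 2) : Admissible n k := by
  have hn' : (1 : ℝ) ≤ n := by exact_mod_cast hn
  exact ⟨h1, h2, by linarith⟩

theorem two_mul_div_add_four_lt_two (n : ℕ) : 2 * (n : ℝ) / (n + 4) < 2 := by
  rw [div_lt_iff₀ (by positivity)]; linarith

theorem sourceBound_of_expL2Norm_le (hn : 1 ≤ n) {u : ℝ → Space n → ℝ} {M : ℝ} (hM : 0 < M)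
    (hMn : M < 1 / (6 * ((n : ℝ) + 1))) (hu : ∀ t, 0 < t → MemExpL2 (u t))
    (hb : ∀ t, 0 < t → expL2Norm (u t) ≤ 2 * M) : SourceBound (sourceConst n M) u := by
  intro s hs k hk
  refine eLpNorm_nonlin_le hn (by positivity) ?_
    (modular_le_one_of_expL2Norm_lt (hu s hs) ((hb s hs).trans_lt (by linarith))) hk.1 hk.2.1 hk.2.2
  have hn0 : (0 : ℝ) < (n : ℝ) + 1 := by positivity
  rw [lt_div_iff₀ (by positivity)] at hMn
  have hM6 : M * 6 ≤ 1 := by nlinarith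
  nlinarith

end ExpHeat

theorem theorem2p3 (n : ℕ) (hn : 1 ≤ n) :
    ∃ (ε C : ℝ) (F : ℝ → ℝ → ℝ), 0 < ε ∧ 0 < C ∧ (∀ r N : ℝ, 0 < F r N) ∧
      ∀ (φ : ExpHeat.Space n → ℝ) (u : ℝ → ExpHeat.Space n → ℝ) (p : ℝ),
        ExpHeat.MemExpL2 φ → (∀ᵐ x, 0 ≤ φ x) →
        ExpHeat.IsUniquePositiveBoundedSolution φ u →
        1 ≤ p → p < 2 → MemLp φ (ENNReal.ofReal p) volume →
        ExpHeat.expL2Norm φ <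
          min ε (F (ExpHeat.pStar n p) (ExpHeat.lpNorm (ExpHeat.pStar n p) φ)) →
        (∀ q : ENNReal, ENNReal.ofReal (ExpHeat.pStar n p) ≤ q → ∀ t : ℝ, 0 < t →
          eLpNorm (u t) q volume ≤
            ENNReal.ofReal (C * t ^ ExpHeat.decayExponent n (ExpHeat.pStar n p) q *
              ExpHeat.interNorm (ExpHeat.pStar n p) φ)) ∧
        (ExpHeat.pOne n < p →
          ∀ q : ENNReal, ENNReal.ofReal (ExpHeat.pStar n p) ≤ q →
            (fun t : ℝ => (eLpNorm (u t) q volume).toReal) =o[atTop]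
              (fun t : ℝ => t ^ ExpHeat.decayExponent n (ExpHeat.pStar n p) q)) := by
  have hF : ∀ r N : ℝ, ∃ δ : ℝ, 0 < δ ∧ (0 < r → r < 2 → ∃ T : ℝ, 0 < T ∧
      ∀ M : ℝ, 0 < M → M < 1 → M < δ →
      ExpHeat.decayConst n * max M N * T ^ (-((n : ℝ) / (2 * r))) ≤ 1 ∧
      Real.exp 1 * (ExpHeat.decayConst n * max M N) ^ (1 + 4 / (n : ℝ)) *
        (T ^ (1 - 2 / r) / (2 / r - 1)) ≤ max M N / 2 ∧
      ExpHeat.sourceConst n M * (2 * T) ≤ max M N ∧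
      2 * ExpHeat.sourceConst n M * (2 * T) ^ (1 - (n : ℝ) / (2 * (n + 1)) + n / (2 * r)) ≤
        max M N) := by
    intro r N
    by_cases h : 0 < r ∧ r < 2
    · obtain ⟨T, δ, hT, hδ, hTδ⟩ := ExpHeat.exists_threshold hn h.1 h.2 N
      exact ⟨δ, hδ, fun _ _ => ⟨T, hT, hTδ⟩⟩
    · exact ⟨1, one_pos, fun h1 h2 => absurd ⟨h1, h2⟩ h⟩
  choose F hF0 hFT using hF
  have hC := ExpHeat.decayConst_ge n
  refine ⟨1 / (6 * ((n : ℝ) + 1)), ExpHeat.decayConst n, F, by positivity, by linarith, hF0, ?_⟩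
  intro φ u p hφ _ huniq hp1 hp2 hφp hsmall
  have hu := huniq.sol.mild
  have h2n := ExpHeat.two_mul_div_add_four_lt_two n
  set r := ExpHeat.pStar n p with hrdef
  have hpr : p ≤ r := le_max_left _ _
  have hr1 : 1 ≤ r := hp1.trans hpr
  have hr0 : 0 < r := by linarith
  have hr2 : r < 2 := max_lt hp2 h2n
  have hr : ExpHeat.Admissible n r :=
    ExpHeat.admissible_of_le_of_lt_two hn hr1 (le_max_right _ _) hr2
  have hφr : MemLp φ (ENNReal.ofReal r) volume :=
    ExpHeat.memLp_of_memLp_of_memLp_two (by linarith) hpr hr2.le hφp hφ.memLp_two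
  set M := ExpHeat.expL2Norm φ with hM
  set N := ExpHeat.lpNorm r φ with hN
  rcases (ExpHeat.expL2Norm_nonneg φ).eq_or_lt with hM0 | hM0
  · -- If the norm of `φ` vanishes, then so does the solution.
    have hzero : ∀ t, 0 < t → ∀ q : ENNReal, eLpNorm (u t) q volume = 0 := by
      intro t ht q
      have h := ExpHeat.ae_eq_zero_of_expL2Norm_le_zero (hu.mem t ht)
        ((huniq.sol.bound t ht).trans (by rw [← hM0, mul_zero]))
      rw [eLpNorm_congr_ae h, eLpNorm_zero]
    refine ⟨fun q _ t ht => by simp [hzero t ht q], fun _ q _ => ?_⟩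
    refine (isLittleO_zero _ _).congr' ?_ EventuallyEq.rfl
    filter_upwards [eventually_gt_atTop 0] with t ht
    simp [hzero t ht q]
  obtain ⟨hMε, hMF⟩ := lt_min_iff.1 hsmall
  have hM1 : M < 1 := by
    refine hMε.trans_le ((div_le_one (by positivity)).2 ?_)
    have : (0 : ℝ) ≤ n := by positivity
    linarith
  obtain ⟨T, hT, hTM⟩ := hFT r N hr0 hr2
  obtain ⟨c1, c2, c3, c4⟩ := hTM M hM0 hM1 hMF
  have ha : 0 < ExpHeat.sourceConst n M := by
    have := ExpHeat.two_le_nonlinConst n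
    unfold ExpHeat.sourceConst
    have : 0 < M := hM0
    positivity
  have hf := ExpHeat.sourceBound_of_expL2Norm_le hn hM0 hMε hu.mem huniq.sol.bound
  have hm : 0 < max M N := lt_max_of_lt_left hM0
  have hφm : eLpNorm φ (ENNReal.ofReal r) volume ≤ ENNReal.ofReal (max M N) := by
    rw [← ENNReal.ofReal_toReal hφr.2.ne]
    exact ENNReal.ofReal_le_ofReal (le_max_right _ _)
  have hdec : ∀ t, 0 < t → ExpHeat.DecayBound r (ExpHeat.decayConst n * max M N) u t :=
    fun t ht => ExpHeat.decayBound_of_sourceBound hn hu hr hr2 hφr ha hf hm hφm hT c1 c2 c3 c4 ht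
  have hX : 0 < ExpHeat.decayConst n * max M N := by positivity
  refine ⟨fun q hq t ht => ?_, fun hp q hq => ?_⟩
  · refine ((hdec t ht).eLpNorm_le hr0 hX ht hq).trans_eq ?_
    rw [mul_right_comm]
    rfl
  · have hl : ExpHeat.Admissible n (ExpHeat.pOne n) :=
      ExpHeat.admissible_of_le_of_lt_two hn (le_max_left _ _) (le_max_right _ _) (by linarith)
    exact ExpHeat.isLittleO_of_eventually_decayBound hr0 (fun η hη =>
      ExpHeat.eventually_decayBound hn hu hr hr2 hφr ha hf hl (hp.trans_le hpr) hX hdec hη) hq
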